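/- **Setting.** Let $X$ be a nonsingular projective curve over the finite field $\mathbb{F}_q$ with function field $K$, let $\infty$ be a closed point of $X$, and let $A$ be the Dedekind domain of functions regular on $X\setminus\{\infty\}$, with fraction field $K$. Let $L$ be a field containing $\mathbb{F}_q$ with algebraic closure $\overline{L}$, let $\iota:A\to L$ be an $\mathbb{F}_q$-algebra homomorphism, and let $\phi$ be a Drinfeld $A$-module over $L$ with respect to $\iota$: a ring homomorphism $a\mapsto\phi_a$ from $A$ to the ring $L\{\tau\}$ of $\mathbb{F}_q$-linear polynomials (under addition and composition, $\tau(x)=x^q$) such that $\phi_a$ has linear coefficient $\iota(a)$ for all $a$, and $\phi_a\ne\iota(a)$ for some $a$. The characteristic of $\phi$ is $\mathfrak p=\ker\iota$. For $f=\sum_{i=0}^d a_i\tau^i\in\overline{L}\{\tau\}$ the adjoint $f^*$ is the map $f^*(x)=\sum_{i=0}^d (a_ix)^{1/q^i}$ on $\overline{L}$. If $f(\alpha)=0$ there is a unique $g_\alpha\in\overline{L}\{\tau\}$ with $f\circ\alpha=g_\alpha\circ(1-\tau)$, and for $f\neq 0$, $\alpha\in\ker f$ and $\beta\in\ker f^*$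 one puts $\langle\alpha,\beta\rangle_f=g_\alpha^*(\beta)\in\mathbb{F}_q$. Let $\phi(\overline{L})$ and $\phi^*(\overline{L})$ be the group $\overline{L}$ on which $a\in A$ acts as $\phi_a$ and as $\phi_a^*$ respectively, and for nonzero $a \in A$ let $\phi[a]$, $\phi^*[a]$ be the respective kernels of $a$. For $x\in\phi[a]$, $y\in\phi^*[a]$ let $[x,y]_a\in\operatorname{Hom}_{\mathbb{F}_q}(A/a,\mathbb{F}_q)$ be the functional $c\mapsto\langle\phi_c(x),y\rangle_{\phi_a}$. Let $\mathfrak q$ be a nonzero prime of $A$ with $\mathfrak q\neq\mathfrak p$, let $A_{\mathfrak q}$, $K_{\mathfrak q}$ be the completions at $\mathfrak q$, and put $$T_{\mathfrak q}(\phi)=\operatorname{Hom}_A(K_{\mathfrak q}/A_{\mathfrak q},\phi(\overline{L})),\qquad T_{\mathfrak q}(\phi^*)=\operatorname{Hom}_A(K_{\mathfrak q}/A_{\mathfrak q},\phi^*(\overline{L})).$$ These, and $\operatorname{Hom}_{\mathbb{F}_q}(K_{\mathfrak q}/A_{\mathfrak q},\mathbb{F}_q)$, are $A_{\mathfrak q}$-modules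 through the action on $K_{\mathfrak q}/A_{\mathfrak q}$ and carry the topology of pointwise convergence (with $\overline L$ and $\mathbb{F}_q$ discrete). The group $\operatorname{Gal}(L^{\mathrm{sep}}/L)=\operatorname{Aut}(\overline{L}/L)$ acts on the Tate modules through $\overline{L}$. **Proposition.** There is an $A_{\mathfrak q}$-bilinear pairing $$[\;,\;]_{\mathfrak q}:T_{\mathfrak q}(\phi)\times T_{\mathfrak q}(\phi^*)\to\operatorname{Hom}_{\mathbb{F}_q}(K_{\mathfrak q}/A_{\mathfrak q},\mathbb{F}_q)$$ with $[\alpha,\beta]_{\mathfrak q}(b)=\langle\alpha(b),\beta(a^{-1})\rangle_{\phi_a}$ for every $b\in K_{\mathfrak q}/A_{\mathfrak q}$ and every nonzero $a\in A$ with $ab=0$ (where $a^{-1}$ denotes its class in $K_{\mathfrak q}/A_{\mathfrak q}$), and it has the following properties. 1. It is continuous. 2. It is Galois-equivariant: $[\sigma\alpha,\sigma\beta]_{\mathfrak q}=[\alpha,\beta]_{\mathfrak q}$ for all $\sigma\in\operatorname{Gal}(L^{\mathrm{sep}}/L)$ (trivial action on the target). 3. It is perfect: the induced maps from $T_{\mathfrak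 q}(\phi)$ to $\operatorname{Hom}_{A_{\mathfrak q}}(T_{\mathfrak q}(\phi^*),\operatorname{Hom}_{\mathbb{F}_q}(K_{\mathfrak q}/A_{\mathfrak q},\mathbb{F}_q))$ and from $T_{\mathfrak q}(\phi^*)$ to $\operatorname{Hom}_{A_{\mathfrak q}}(T_{\mathfrak q}(\phi),\operatorname{Hom}_{\mathbb{F}_q}(K_{\mathfrak q}/A_{\mathfrak q},\mathbb{F}_q))$ are bijective. 4. It is the inverse limit of the pairings $[\;,\;]_{a^n}$, for each $a\in A$ generating a power $\mathfrak q^m$, $m\ge1$: the maps $\alpha\mapsto(\alpha(a^{-n}))_n$, $\beta\mapsto(\beta(a^{-n}))_n$ and $\mu\mapsto(c\mapsto\mu(ca^{-n}))_n$ are bijections from $T_{\mathfrak q}(\phi)$, $T_{\mathfrak q}(\phi^*)$ and $\operatorname{Hom}_{\mathbb{F}_q}(K_{\mathfrak q}/A_{\mathfrak q},\mathbb{F}_q)$ onto $\varprojlim\phi[a^n]$, $\varprojlim\phi^*[a^n]$ (transition maps: the action of $a$) and $\varprojlim\operatorname{Hom}_{\mathbb{F}_q}(A/a^n,\mathbb{F}_q)$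 (transition maps: restriction along $A/a^n\cong a^{-n}A/A\subseteq a^{-(n+1)}A/A\cong A/a^{n+1}$), and $[\alpha,\beta]_{\mathfrak q}(ca^{-n})=[\alpha(a^{-n}),\beta(a^{-n})]_{a^n}(c)$ for all $n\geq 0$ and $c\in A$. Moreover $\operatorname{Hom}_{\mathbb{F}_q}(K_{\mathfrak q}/A_{\mathfrak q},\mathbb{F}_q)\cong A_{\mathfrak q}$ as topological $A_{\mathfrak q}$-modules. -/

import Mathlib

open Polynomial IsDedekindDomain

set_option linter.unusedSectionVars false

noncomputable section

namespace DrinfeldTate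

/-! ### `F_q`-linear polynomials, adjoints, and the pairing between `ker f` and `ker f*` -/

section Linear

variable (Fq : Type*) [Field Fq] [Fintype Fq] {F : Type*} [Field F]

/-- `f` is an `F_q`-linear polynomial `∑ a_i X^(q^i)`. These polynomials, under addition and
composition, form the twisted polynomial ring `F{τ}`, with `τ = X^q`. -/
def IsLinear (f : F[X]) : Prop :=
  ∀ n, f.coeff n ≠ 0 → ∃ i, n = Fintype.card Fq ^ i

variable [Algebra Fq F]

theorem frobenius_bijective [IsAlgClosed F] :
    Function.Bijective (FiniteField.frobeniusAlgHom Fq F) := by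
  refine ⟨(FiniteField.frobeniusAlgHom Fq F).toRingHom.injective, fun x => ?_⟩
  obtain ⟨z, hz⟩ := IsAlgClosed.exists_pow_nat_eq x (Fintype.card_pos (α := Fq))
  exact ⟨z, by simpa [FiniteField.coe_frobeniusAlgHom] using hz⟩

/-- The automorphism `τ : x ↦ x^q` of an algebraically closed field containing `F_q`. -/
def tau (F : Type*) [Field F] [Algebra Fq F] [IsAlgClosed F] : F ≃ₐ[Fq] F :=
  AlgEquiv.ofBijective (FiniteField.frobeniusAlgHom Fq F) (frobenius_bijective Fq)

theorem tau_apply [IsAlgClosed F] (x : F) : tau Fq F x = x ^ Fintype.card Fq := rfl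

theorem tau_pow_apply [IsAlgClosed F] (i : ℕ) (x : F) :
    (tau Fq F ^ i) x = x ^ Fintype.card Fq ^ i := by
  induction i with
  | zero => simp
  | succ i ih => rw [pow_succ', AlgEquiv.mul_apply, ih, tau_apply, ← pow_mul, pow_succ]

/-- The adjoint `f* = ∑ a_i^(1/q^i) τ^(-i)` of the `F_q`-linear polynomial `f = ∑ a_i τ^i`,
as a function: `f*(x) = ∑ (a_i x)^(1/q^i)`. -/
def adjoint [IsAlgClosed F] (f : F[X]) (x : F) : F :=
  ∑ i ∈ Finset.range (f.natDegree + 1),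
    ((tau Fq F)⁻¹ ^ i) (f.coeff (Fintype.card Fq ^ i) * x)

/-- `g` is the `F_q`-linear polynomial with `f ∘ α = g ∘ (1 - τ)`. -/
def IsCofactor (f : F[X]) (α : F) (g : F[X]) : Prop :=
  IsLinear Fq g ∧ f.comp (C α * X) = g.comp (X - X ^ Fintype.card Fq)

open Classical in
/-- The polynomial `g_α` with `f ∘ α = g_α ∘ (1 - τ)`, for `α ∈ ker f`; it exists and is unique by
`existsUnique_cofactor`. -/
def cofactor (f : F[X]) (α : F) : F[X] :=
  if h : ∃ g, IsCofactor Fq f α g then h.choose else 0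

/-- The pairing `⟨α, β⟩_f = g_α*(β)` for `α ∈ ker f` and `β ∈ ker f*`. -/
def pairing [IsAlgClosed F] (f : F[X]) (α β : F) : F :=
  adjoint Fq (cofactor Fq f α) β

variable {Fq}

theorem one_lt_q : 1 < Fintype.card Fq := Fintype.one_lt_card

theorem IsLinear.eq_sum {f : F[X]} (hf : IsLinear Fq f) {N : ℕ} (hN : f.natDegree + 1 ≤ N) :
    f = ∑ i ∈ Finset.range N, C (f.coeff (Fintype.card Fq ^ i)) * X ^ Fintype.card Fq ^ i := by
  ext n
  simp only [finsetSum_coeff, coeff_C_mul, coeff_X_pow, mul_ite, mul_one, mul_zero]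
  by_cases h : f.coeff n = 0
  · rw [h]
    symm
    refine Finset.sum_eq_zero fun i _ => ?_
    split_ifs with hn
    · rw [← hn, h]
    · rfl
  · obtain ⟨i, rfl⟩ := hf n h
    rw [Finset.sum_eq_single i]
    · simp
    · intro j _ hj
      rw [if_neg]
      intro e
      exact hj (Nat.pow_right_injective (one_lt_q (Fq := Fq)) e).symm
    · intro hi
      exfalso
      apply h
      apply coeff_eq_zero_of_natDegree_lt
      rw [Finset.mem_range] at hi
      have := Nat.lt_pow_self (n := i) (one_lt_q (Fq := Fq))
      omega

theorem isLinear_monomial (c : F) (i : ℕ) : IsLinear Fq (C c * X ^ Fintype.card Fq ^ i) := by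
  intro n hn
  rw [coeff_C_mul, coeff_X_pow] at hn
  refine ⟨i, ?_⟩
  by_contra h
  simp [h] at hn

theorem IsLinear.add {f g : F[X]} (hf : IsLinear Fq f) (hg : IsLinear Fq g) :
    IsLinear Fq (f + g) := by
  intro n hn
  by_cases h : f.coeff n = 0
  · exact hg n (by simpa [h] using hn)
  · exact hf n h

theorem IsLinear.sum {ι : Type*} (s : Finset ι) (f : ι → F[X]) (h : ∀ i ∈ s, IsLinear Fq (f i)) :
    IsLinear Fq (∑ i ∈ s, f i) :=
  Finset.sum_induction f (IsLinear Fq) (fun _ _ => IsLinear.add) (fun n hn => by simp at hn) h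

theorem IsLinear.neg {f : F[X]} (hf : IsLinear Fq f) : IsLinear Fq (-f) := by
  intro n hn
  exact hf n (by simpa using hn)

theorem IsLinear.induction {P : F[X] → Prop} {f : F[X]} (hf : IsLinear Fq f) (h0 : P 0)
    (hadd : ∀ f g, P f → P g → P (f + g))
    (hmon : ∀ (c : F) (i : ℕ), P (C c * X ^ Fintype.card Fq ^ i)) : P f := by
  rw [hf.eq_sum le_rfl]
  exact Finset.sum_induction _ P hadd h0 fun i _ => hmon _ i

theorem IsLinear.eval_add {f : F[X]} (hf : IsLinear Fq f) (x y : F) :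
    f.eval (x + y) = f.eval x + f.eval y := by
  refine hf.induction (P := fun f => f.eval (x + y) = f.eval x + f.eval y) (by simp) ?_ ?_
  · intro f g h1 h2
    simp only [Polynomial.eval_add, h1, h2]
    ring
  · intro c i
    have : ∀ z : F, z ^ Fintype.card Fq ^ i = (FiniteField.frobeniusAlgHom Fq F)^[i] z := by
      intro z
      rw [FiniteField.coe_frobeniusAlgHom, pow_iterate]
    simp only [eval_mul, eval_C, eval_pow, eval_X, this]
    rw [← AlgHom.coe_pow, map_add, mul_add]

theorem add_pow_q (i : ℕ) (g h : F[X]) :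
    (g + h) ^ Fintype.card Fq ^ i = g ^ Fintype.card Fq ^ i + h ^ Fintype.card Fq ^ i := by
  have : ∀ z : F[X], z ^ Fintype.card Fq ^ i = (FiniteField.frobeniusAlgHom Fq F[X])^[i] z := by
    intro z
    rw [FiniteField.coe_frobeniusAlgHom, pow_iterate]
  simp only [this]
  rw [← AlgHom.coe_pow, map_add]

theorem sub_pow_q (i : ℕ) (g h : F[X]) :
    (g - h) ^ Fintype.card Fq ^ i = g ^ Fintype.card Fq ^ i - h ^ Fintype.card Fq ^ i := by
  rw [eq_sub_iff_add_eq, ← add_pow_q, sub_add_cancel]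

theorem comp_injective {g h : F[X]} (e : g.comp (X - X ^ Fintype.card Fq) =
    h.comp (X - X ^ Fintype.card Fq)) : g = h := by
  have h1 : (g - h).comp (X - X ^ Fintype.card Fq) = 0 := by rw [sub_comp, e, sub_self]
  rcases comp_eq_zero_iff.mp h1 with h0 | ⟨_, h0⟩
  · exact sub_eq_zero.mp h0
  · exfalso
    have h2 := congrArg (fun p => coeff p 1) h0
    have hq1 : (1 : ℕ) ≠ Fintype.card Fq := (one_lt_q (Fq := Fq)).ne
    simp only [coeff_sub, coeff_X_one, coeff_X_pow, hq1, if_false, coeff_C, one_ne_zero] at h2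
    simp at h2

theorem existsUnique_cofactor {f : F[X]} (hf : IsLinear Fq f) {α : F} (hα : f.eval α = 0) :
    ∃! g, IsCofactor Fq f α g := by
  let N := f.natDegree + 1
  let G : ℕ → F := fun n =>
    ∑ j ∈ Finset.range n, f.coeff (Fintype.card Fq ^ j) * α ^ Fintype.card Fq ^ j
  have hG : G N = 0 := by
    rw [← hα]
    conv_rhs => rw [hf.eq_sum (N := N) le_rfl]
    simp [G, eval_finsetSum]
  have ex : IsCofactor Fq f α
      (∑ i ∈ Finset.range N, C (G (i + 1)) * X ^ Fintype.card Fq ^ i) := by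
    refine ⟨IsLinear.sum _ _ fun i _ => isLinear_monomial _ i, ?_⟩
    have key : ∀ n, ∑ i ∈ Finset.range n,
        C (G (i + 1)) * (X ^ Fintype.card Fq ^ i - X ^ Fintype.card Fq ^ (i + 1)) =
        (∑ i ∈ Finset.range n, C (f.coeff (Fintype.card Fq ^ i) * α ^ Fintype.card Fq ^ i) *
          X ^ Fintype.card Fq ^ i) - C (G n) * X ^ Fintype.card Fq ^ n := by
      intro n
      induction n with
      | zero => simp [G]
      | succ n ih =>
        have : G (n + 1) = G n + f.coeff (Fintype.card Fq ^ n) * α ^ Fintype.card Fq ^ n :=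
          Finset.sum_range_succ _ _
        rw [Finset.sum_range_succ, ih, Finset.sum_range_succ, this]
        simp only [C_add]
        ring
    have e1 : (∑ i ∈ Finset.range N, C (G (i + 1)) * X ^ Fintype.card Fq ^ i : F[X]).comp
          (X - X ^ Fintype.card Fq) =
        ∑ i ∈ Finset.range N,
          C (G (i + 1)) * (X ^ Fintype.card Fq ^ i - X ^ Fintype.card Fq ^ (i + 1)) := by
      rw [Polynomial.sum_comp]
      refine Finset.sum_congr rfl fun i _ => ?_
      simp only [mul_comp, C_comp, pow_comp, X_comp]
      rw [sub_pow_q, ← pow_mul, ← pow_succ']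
    rw [e1, key, hG]
    conv_lhs => rw [hf.eq_sum (N := N) le_rfl]
    rw [Polynomial.sum_comp]
    simp only [mul_comp, C_comp, pow_comp, X_comp, mul_pow, C_mul, C_pow, C_0, zero_mul, sub_zero,
      mul_assoc]
  refine ⟨_, ex, fun g' hg' => comp_injective (Fq := Fq) ?_⟩
  rw [← hg'.2, ex.2]

theorem isCofactor_cofactor {f : F[X]} (hf : IsLinear Fq f) {α : F} (hα : f.eval α = 0) :
    IsCofactor Fq f α (cofactor Fq f α) := by
  have h : ∃ g, IsCofactor Fq f α g := (existsUnique_cofactor hf hα).exists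
  rw [cofactor, dif_pos h]
  exact h.choose_spec

section Adjoint

variable [IsAlgClosed F]

theorem adjoint_eq_sum (f : F[X]) (x : F) {N : ℕ} (hN : f.natDegree + 1 ≤ N) :
    adjoint Fq f x =
      ∑ i ∈ Finset.range N, ((tau Fq F)⁻¹ ^ i) (f.coeff (Fintype.card Fq ^ i) * x) := by
  refine Finset.sum_subset (Finset.range_mono hN) fun i _ hi => ?_
  rw [coeff_eq_zero_of_natDegree_lt, zero_mul, map_zero]
  rw [Finset.mem_range] at hi
  have := Nat.lt_pow_self (n := i) (one_lt_q (Fq := Fq))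
  omega

theorem adjoint_add_left (f g : F[X]) (x : F) :
    adjoint Fq (f + g) x = adjoint Fq f x + adjoint Fq g x := by
  have h1 := natDegree_add_le f g
  rw [adjoint_eq_sum (f + g) x (N := max f.natDegree g.natDegree + 1) (by omega),
    adjoint_eq_sum f x (N := max f.natDegree g.natDegree + 1) (by omega),
    adjoint_eq_sum g x (N := max f.natDegree g.natDegree + 1) (by omega),
    ← Finset.sum_add_distrib]
  refine Finset.sum_congr rfl fun i _ => ?_
  rw [coeff_add, add_mul, map_add]

theorem adjoint_add_right (f : F[X]) (x y : F) :
    adjoint Fq f (x + y) = adjoint Fq f x + adjoint Fq f y := by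
  simp only [adjoint, mul_add, map_add, Finset.sum_add_distrib]

theorem adjoint_zero_left (x : F) : adjoint Fq 0 x = 0 := by
  simp [adjoint]

theorem adjoint_zero_right (f : F[X]) : adjoint Fq f 0 = 0 := by
  simp [adjoint]

theorem adjoint_monomial (c : F) (i : ℕ) (x : F) :
    adjoint Fq (C c * X ^ Fintype.card Fq ^ i) x = ((tau Fq F)⁻¹ ^ i) (c * x) := by
  rw [adjoint_eq_sum (N := max ((C c * X ^ Fintype.card Fq ^ i).natDegree + 1) (i + 1)) _ _
    (le_max_left _ _), Finset.sum_eq_single i]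
  · simp
  · intro j _ hj
    have : Fintype.card Fq ^ j ≠ Fintype.card Fq ^ i :=
      fun e => hj (Nat.pow_right_injective (one_lt_q (Fq := Fq)) e)
    rw [coeff_C_mul, coeff_X_pow, if_neg this, mul_zero, zero_mul, map_zero]
  · intro h
    exfalso
    apply h
    simp

theorem adjoint_X (x : F) : adjoint Fq (X : F[X]) x = x := by
  simpa using adjoint_monomial (Fq := Fq) (1 : F) 0 x

/-- `(f ∘ g)* = g* ∘ f*`. -/
theorem adjoint_comp {f g : F[X]} (hf : IsLinear Fq f) (hg : IsLinear Fq g) (x : F) :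
    adjoint Fq (f.comp g) x = adjoint Fq g (adjoint Fq f x) := by
  refine hf.induction
    (P := fun f => adjoint Fq (f.comp g) x = adjoint Fq g (adjoint Fq f x)) ?_ ?_ ?_
  · simp [adjoint_zero_left, adjoint_zero_right]
  · intro f₁ f₂ h1 h2
    rw [add_comp, adjoint_add_left, h1, h2, adjoint_add_left, adjoint_add_right]
  · intro c i
    refine hg.induction (P := fun g => adjoint Fq ((C c * X ^ Fintype.card Fq ^ i).comp g) x =
      adjoint Fq g (adjoint Fq (C c * X ^ Fintype.card Fq ^ i) x)) ?_ ?_ ?_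
    · simp [adjoint_zero_left]
    · intro g₁ g₂ h1 h2
      simp only [mul_comp, C_comp, pow_comp, X_comp] at h1 h2 ⊢
      rw [add_pow_q, mul_add, adjoint_add_left, h1, h2, adjoint_add_left]
    · intro d j
      simp only [mul_comp, C_comp, pow_comp, X_comp]
      have e : C c * (C d * X ^ Fintype.card Fq ^ j) ^ Fintype.card Fq ^ i =
          C (c * (tau Fq F ^ i) d) * X ^ Fintype.card Fq ^ (j + i) := by
        rw [tau_pow_apply, mul_pow, ← pow_mul, ← pow_add, C_mul, C_pow, mul_assoc]
      rw [e, adjoint_monomial, adjoint_monomial, adjoint_monomial, pow_add, AlgEquiv.mul_apply]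
      congr 1
      rw [map_mul, map_mul, map_mul, ← AlgEquiv.mul_apply ((tau Fq F)⁻¹ ^ i), inv_pow,
        inv_mul_cancel, AlgEquiv.one_apply]
      ring

/-- Automorphisms over a field containing the coefficients commute with adjoints. -/
theorem adjoint_map_apply {L : Type*} [Field L] [Algebra L F] (σ : F ≃ₐ[L] F) (f : L[X]) (x : F) :
    adjoint Fq (f.map (algebraMap L F)) (σ x) = σ (adjoint Fq (f.map (algebraMap L F)) x) := by
  have h1 : ∀ y, σ ((tau Fq F)⁻¹ y) = (tau Fq F)⁻¹ (σ y) := by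
    intro y
    apply (tau Fq F).injective
    rw [← AlgEquiv.mul_apply, mul_inv_cancel, AlgEquiv.one_apply, tau_apply, ← map_pow,
      ← tau_apply, ← AlgEquiv.mul_apply, mul_inv_cancel, AlgEquiv.one_apply]
  have h2 : ∀ (i : ℕ) (y), σ (((tau Fq F)⁻¹ ^ i) y) = ((tau Fq F)⁻¹ ^ i) (σ y) := by
    intro i
    induction i with
    | zero => intro y; simp
    | succ i ih => intro y; rw [pow_succ', AlgEquiv.mul_apply, h1, ih, AlgEquiv.mul_apply]
  simp only [adjoint, map_sum, h2, map_mul, coeff_map, AlgEquiv.commutes]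

end Adjoint

end Linear

/-! ### Drinfeld modules -/

/-- `A` is the ring of regular functions on `X ∖ {∞}`, where `X` is a nonsingular projective curve
over `F_q` with function field `K` and `∞` is a closed point of `X`: `K` is an algebraic function
field in one variable over `F_q`, the closed points of `X` are the valuation rings of `K` other
than `K` (all contain the finite field `F_q`), and `A` consists of the elements of `K` that are
regular at every point other than `∞`. -/
def IsRegularAwayFromPoint (Fq A K : Type*) [Field Fq] [CommRing A] [Field K] [Algebra Fq K]
    [Algebra A K] : Prop :=
  (∃ t : K, Transcendental Fq t ∧ FiniteDimensional (IntermediateField.adjoin Fq {t}) K) ∧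
  ∃ infty : ValuationSubring K, infty ≠ ⊤ ∧
    ∀ x : K, x ∈ Set.range (algebraMap A K) ↔ ∀ O : ValuationSubring K, O ≠ infty → x ∈ O

/-- A Drinfeld `A`-module over `L`, relative to `ι : A → L`: a ring homomorphism `a ↦ φ_a` from `A`
to the twisted polynomial ring `L{τ}` (the `F_q`-linear polynomials under addition and composition)
such that `φ_a` has linear coefficient `ι a`, and `φ_a ≠ ι a` for some `a`. -/
structure DrinfeldModule (Fq : Type*) [Field Fq] [Fintype Fq] {A L : Type*} [CommRing A] [Field L]
    [Algebra Fq A] [Algebra Fq L] (ι : A →ₐ[Fq] L) where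
  toPoly : A → L[X]
  isLinear : ∀ a, IsLinear Fq (toPoly a)
  map_one : toPoly 1 = X
  map_add : ∀ a b, toPoly (a + b) = toPoly a + toPoly b
  map_mul : ∀ a b, toPoly (a * b) = (toPoly a).comp (toPoly b)
  coeff_one : ∀ a, (toPoly a).coeff 1 = ι a
  nontrivial : ∃ a, toPoly a ≠ C (ι a) * X

namespace DrinfeldModule

variable {Fq : Type*} [Field Fq] [Fintype Fq] {A L : Type*} [CommRing A] [Field L]
  [Algebra Fq A] [Algebra Fq L] {ι : A →ₐ[Fq] L} (φ : DrinfeldModule Fq ι)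

/-- `φ_a` with its coefficients viewed in the algebraic closure of `L`. -/
def polyBar (a : A) : (AlgebraicClosure L)[X] :=
  (φ.toPoly a).map (algebraMap L (AlgebraicClosure L))

theorem isLinear_polyBar (a : A) : IsLinear Fq (φ.polyBar a) := by
  intro n hn
  refine φ.isLinear a n fun h => hn ?_
  rw [polyBar, coeff_map, h, _root_.map_zero]

theorem polyBar_one : φ.polyBar 1 = X := by
  rw [polyBar, φ.map_one, map_X]

theorem polyBar_add (a b : A) : φ.polyBar (a + b) = φ.polyBar a + φ.polyBar b := by
  rw [polyBar, φ.map_add, Polynomial.map_add]; rfl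

theorem polyBar_mul (a b : A) : φ.polyBar (a * b) = (φ.polyBar a).comp (φ.polyBar b) := by
  rw [polyBar, φ.map_mul, Polynomial.map_comp]; rfl

theorem polyBar_zero : φ.polyBar 0 = 0 := by
  have := φ.polyBar_add 0 0
  rwa [add_zero, left_eq_add] at this

/-- `φ(L̄)`: the additive group of the algebraic closure of `L`, with `a` acting as `φ_a`. -/
def Points (_ : DrinfeldModule Fq ι) : Type _ := AlgebraicClosure L

/-- `φ*(L̄)`: the additive group of the algebraic closure of `L`, with `a` acting as `φ_a*`. -/
def AdjPoints (_ : DrinfeldModule Fq ι) : Type _ := AlgebraicClosure L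

instance : AddCommGroup φ.Points := inferInstanceAs (AddCommGroup (AlgebraicClosure L))

instance : AddCommGroup φ.AdjPoints := inferInstanceAs (AddCommGroup (AlgebraicClosure L))

/-- The underlying element of the algebraic closure. -/
def Points.val {φ : DrinfeldModule Fq ι} : φ.Points ≃+ AlgebraicClosure L :=
  AddEquiv.refl (AlgebraicClosure L)

/-- The underlying element of the algebraic closure. -/
def AdjPoints.val {φ : DrinfeldModule Fq ι} : φ.AdjPoints ≃+ AlgebraicClosure L :=
  AddEquiv.refl (AlgebraicClosure L)

instance : Module A φ.Points where
  smul a x := Points.val.symm ((φ.polyBar a).eval (Points.val x))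
  one_smul x := by
    change (φ.polyBar 1).eval (Points.val x) = Points.val x
    rw [polyBar_one, eval_X]
  mul_smul a b x := by
    change (φ.polyBar (a * b)).eval (Points.val x) =
      (φ.polyBar a).eval ((φ.polyBar b).eval (Points.val x))
    rw [polyBar_mul, eval_comp]
  smul_zero a := by
    change (φ.polyBar a).eval (0 : AlgebraicClosure L) = 0
    have := (φ.isLinear_polyBar a).eval_add 0 0
    rwa [add_zero, left_eq_add] at this
  smul_add a x y := (φ.isLinear_polyBar a).eval_add (Points.val x) (Points.val y)
  add_smul a b x := by
    change (φ.polyBar (a + b)).eval (Points.val x) =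
      (φ.polyBar a).eval (Points.val x) + (φ.polyBar b).eval (Points.val x)
    rw [polyBar_add, Polynomial.eval_add]
  zero_smul x := by
    change (φ.polyBar 0).eval (Points.val x) = 0
    rw [polyBar_zero, eval_zero]

instance : Module A φ.AdjPoints where
  smul a x := AdjPoints.val.symm (adjoint Fq (φ.polyBar a) (AdjPoints.val x))
  one_smul x := by
    change adjoint Fq (φ.polyBar 1) (AdjPoints.val x) = AdjPoints.val x
    rw [polyBar_one, adjoint_X]
  mul_smul a b x := by
    change adjoint Fq (φ.polyBar (a * b)) (AdjPoints.val x) =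
      adjoint Fq (φ.polyBar a) (adjoint Fq (φ.polyBar b) (AdjPoints.val x))
    rw [mul_comm, polyBar_mul, adjoint_comp (φ.isLinear_polyBar b) (φ.isLinear_polyBar a)]
  smul_zero a := adjoint_zero_right (φ.polyBar a)
  smul_add a x y := adjoint_add_right (φ.polyBar a) (AdjPoints.val x) (AdjPoints.val y)
  add_smul a b x := by
    change adjoint Fq (φ.polyBar (a + b)) (AdjPoints.val x) =
      adjoint Fq (φ.polyBar a) (AdjPoints.val x) + adjoint Fq (φ.polyBar b) (AdjPoints.val x)
    rw [polyBar_add, adjoint_add_left]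
  zero_smul x := by
    change adjoint Fq (φ.polyBar 0) (AdjPoints.val x) = 0
    rw [polyBar_zero, adjoint_zero_left]

theorem Points.val_smul (a : A) (x : φ.Points) :
    Points.val (a • x) = (φ.polyBar a).eval (Points.val x) := rfl

theorem AdjPoints.val_smul (a : A) (x : φ.AdjPoints) :
    AdjPoints.val (a • x) = adjoint Fq (φ.polyBar a) (AdjPoints.val x) := rfl

/-- The natural action of `Aut(L̄/L) = Gal(Lˢᵉᵖ/L)` on points. -/
instance : DistribMulAction (AlgebraicClosure L ≃ₐ[L] AlgebraicClosure L) φ.Points :=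
  inferInstanceAs
    (DistribMulAction (AlgebraicClosure L ≃ₐ[L] AlgebraicClosure L) (AlgebraicClosure L))

/-- The natural action of `Aut(L̄/L) = Gal(Lˢᵉᵖ/L)` on points. -/
instance : DistribMulAction (AlgebraicClosure L ≃ₐ[L] AlgebraicClosure L) φ.AdjPoints :=
  inferInstanceAs
    (DistribMulAction (AlgebraicClosure L ≃ₐ[L] AlgebraicClosure L) (AlgebraicClosure L))

instance : SMulCommClass A (AlgebraicClosure L ≃ₐ[L] AlgebraicClosure L) φ.Points where
  smul_comm a σ x := by
    change (φ.polyBar a).eval (σ (Points.val x)) = σ ((φ.polyBar a).eval (Points.val x))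
    rw [polyBar, eval_map_algebraMap, eval_map_algebraMap, aeval_algEquiv]
    rfl

instance : SMulCommClass A (AlgebraicClosure L ≃ₐ[L] AlgebraicClosure L) φ.AdjPoints where
  smul_comm a σ x := adjoint_map_apply σ (φ.toPoly a) (AdjPoints.val x)

end DrinfeldModule

/-! ### Tate modules -/

section Tate

variable {A : Type*} [CommRing A] [IsDedekindDomain A] (K : Type*) [Field K] [Algebra A K]
  [IsFractionRing A K] (v : HeightOneSpectrum A)

/-- The module `K_𝔮 / A_𝔮`. -/
abbrev KmodA : Type _ :=
  v.adicCompletion K ⧸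
    LinearMap.range (Algebra.linearMap (v.adicCompletionIntegers K) (v.adicCompletion K))

/-- The class of `a⁻¹` in `K_𝔮 / A_𝔮`. -/
def invClass (a : A) : KmodA K v :=
  Submodule.Quotient.mk (algebraMap A (v.adicCompletion K) a)⁻¹

/-- `K_𝔮 / A_𝔮` as an `F_q`-vector space, through `F_q → A`. -/
instance (priority := 50) KmodA.moduleFq (Fq : Type*) [Field Fq] [Algebra Fq A] :
    Module Fq (KmodA K v) :=
  Module.compHom _ (algebraMap Fq A)

instance (priority := 50) KmodA.isScalarTower (Fq : Type*) [Field Fq] [Algebra Fq A] :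
    IsScalarTower Fq A (KmodA K v) where
  smul_assoc c a x := by
    change (c • a) • x = algebraMap Fq A c • (a • x)
    rw [Algebra.smul_def, mul_smul]

instance KmodA.smulCommClass : SMulCommClass A (v.adicCompletionIntegers K) (KmodA K v) where
  smul_comm a s x := by
    rw [← algebraMap_smul (v.adicCompletionIntegers K) a x,
      ← algebraMap_smul (v.adicCompletionIntegers K) a (s • x), smul_comm]

instance (priority := 50) KmodA.smulCommClassFq (Fq : Type*) [Field Fq] [Algebra Fq A] :
    SMulCommClass Fq (v.adicCompletionIntegers K) (KmodA K v) where
  smul_comm c s x := smul_comm (algebraMap Fq A c) s x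

/-- `Hom_S(K_𝔮/A_𝔮, N)` (below, `S` is `A` or `F_q`). -/
def HomKmodA (S : Type*) [CommRing S] [Module S (KmodA K v)] (N : Type*) [AddCommGroup N]
    [Module S N] : Type _ :=
  KmodA K v →ₗ[S] N

namespace HomKmodA

variable {K v} {S : Type*} [CommRing S] [Module S (KmodA K v)] {N : Type*} [AddCommGroup N]
    [Module S N]

instance : AddCommGroup (HomKmodA K v S N) := inferInstanceAs (AddCommGroup (KmodA K v →ₗ[S] N))

instance : FunLike (HomKmodA K v S N) (KmodA K v) N :=
  inferInstanceAs (FunLike (KmodA K v →ₗ[S] N) (KmodA K v) N)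

instance : LinearMapClass (HomKmodA K v S N) S (KmodA K v) N :=
  inferInstanceAs (LinearMapClass (KmodA K v →ₗ[S] N) S (KmodA K v) N)

/-- The `A_𝔮`-module structure `(s • f)(b) = f(s b)`. -/
instance [SMulCommClass S (v.adicCompletionIntegers K) (KmodA K v)] :
    Module (v.adicCompletionIntegers K) (HomKmodA K v S N) where
  smul s f := LinearMap.comp (f : KmodA K v →ₗ[S] N)
    ({ toFun := fun b => s • b
       map_add' := smul_add s
       map_smul' := fun c b => (smul_comm c s b).symm } : KmodA K v →ₗ[S] KmodA K v)
  one_smul f := LinearMap.ext fun b => congrArg f (one_smul _ b)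
  mul_smul s t f := LinearMap.ext fun b => congrArg f (by
    change (s * t) • b = t • s • b
    rw [mul_comm, mul_smul])
  smul_zero _ := LinearMap.ext fun _ => rfl
  smul_add _ _ _ := LinearMap.ext fun _ => rfl
  add_smul s t f := LinearMap.ext fun b =>
    (congrArg f (add_smul s t b)).trans (map_add f (s • b) (t • b))
  zero_smul f := LinearMap.ext fun b => (congrArg f (zero_smul _ b)).trans (map_zero f)

theorem smul_apply [SMulCommClass S (v.adicCompletionIntegers K) (KmodA K v)]
    (s : v.adicCompletionIntegers K) (f : HomKmodA K v S N) (b : KmodA K v) :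
    (s • f) b = f (s • b) := rfl

/-- A group acting `S`-linearly on `N` acts on `Hom_S(K_𝔮/A_𝔮, N)` by `(σ • f)(b) = σ (f b)`. -/
instance {G : Type*} [Group G] [DistribMulAction G N] [SMulCommClass S G N] :
    DistribMulAction G (HomKmodA K v S N) :=
  inferInstanceAs (DistribMulAction G (KmodA K v →ₗ[S] N))

theorem group_smul_apply {G : Type*} [Group G] [DistribMulAction G N] [SMulCommClass S G N]
    (σ : G) (f : HomKmodA K v S N) (b : KmodA K v) : (σ • f) b = σ • f b := rfl

/-- The topology of pointwise convergence, `N` being discrete. This is the compact-open topology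
for discrete `K_𝔮/A_𝔮` and `N`. -/
instance : TopologicalSpace (HomKmodA K v S N) :=
  TopologicalSpace.induced (fun f b => f b) (@Pi.topologicalSpace (KmodA K v) (fun _ => N) fun _ => ⊥)

end HomKmodA

/-- `Hom_{F_q}(K_𝔮/A_𝔮, F_q)`. -/
abbrev FqDual (Fq : Type*) [Field Fq] [Algebra Fq A] : Type _ := HomKmodA K v Fq Fq

variable {K v} in
/-- The functional `c ↦ μ(c b)` on `A`. -/
def FqDual.pullback {Fq : Type*} [Field Fq] [Algebra Fq A] (μ : FqDual K v Fq) (b : KmodA K v) :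
    A →ₗ[Fq] Fq :=
  LinearMap.comp (μ : KmodA K v →ₗ[Fq] Fq) ((LinearMap.toSpanSingleton A _ b).restrictScalars Fq)

/-- `lim N[a^n]`, with transition maps `a : N[a^(n+1)] → N[a^n]`. -/
def torsionLimit (N : Type*) [AddCommGroup N] [Module A N] (a : A) : Set (ℕ → N) :=
  {x | ∀ n, a ^ n • x n = 0 ∧ a • x (n + 1) = x n}

/-- `lim Hom_{F_q}(A/a^n, F_q)`, where `A/a^n` is identified with `a^(-n)A/A` and the transition
maps are restrictions along `a^(-n)A/A ⊆ a^(-(n+1))A/A`, that is, along multiplication by `a` from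
`A/a^n` to `A/a^(n+1)`. -/
def dualLimit (Fq : Type*) [Field Fq] [Algebra Fq A] (a : A) : Set (ℕ → A →ₗ[Fq] Fq) :=
  {l | ∀ n c, l n (a ^ n * c) = 0 ∧ l (n + 1) (a * c) = l n c}

namespace DrinfeldModule

variable {Fq : Type*} [Field Fq] [Fintype Fq] {L : Type*} [Field L]
  [Algebra Fq A] [Algebra Fq L] {ι : A →ₐ[Fq] L} (φ : DrinfeldModule Fq ι)

/-- `T_𝔮(φ) = Hom_A(K_𝔮/A_𝔮, φ(L̄))`. -/
abbrev TateModule : Type _ := HomKmodA K v A φ.Points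

/-- `T_𝔮(φ*) = Hom_A(K_𝔮/A_𝔮, φ*(L̄))`. -/
abbrev AdjTateModule : Type _ := HomKmodA K v A φ.AdjPoints

/-- The pairing `⟨x, y⟩_{φ_a} ∈ F_q ⊆ L̄` of `x ∈ φ[a]` and `y ∈ φ*[a]`. The pairing `[x, y]_a` is
the functional `c ↦ ⟨φ_c x, y⟩_{φ_a}` on `A`. -/
def torsionPairing (a : A) (x : φ.Points) (y : φ.AdjPoints) : AlgebraicClosure L :=
  pairing Fq (φ.polyBar a) (Points.val x) (AdjPoints.val y)

end DrinfeldModule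

end Tate

end DrinfeldTate

end

/-!
# The Tate modules of a Drinfeld module and of its adjoint are dual

Put `⟨x, y⟩_a = ⟨x, y⟩_{φ_a}` for `x ∈ φ[a]` and `y ∈ φ*[a]`. Everything comes from three facts
about these pairings.

* They take values in `F_q`, are biadditive, and are compatible:
  `⟨x, y⟩_{ac} = ⟨x, c y⟩_a` if `a x = 0`, and `⟨x, y⟩_{ac} = ⟨c x, y⟩_a` if `a y = 0`. Both rules
  follow from the uniqueness of the cofactor `g_α` (`pairing_comp_of_eval_eq_zero`,
  `pairing_comp_of_adjoint_eq_zero`).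
* For `a ∉ 𝔭` the pairing is perfect. The polynomial `φ_a` is then separable, so `φ[a]` and
  `φ*[a]` both have `deg φ_a` elements, while for `α ≠ 0` the kernel of `g_α*` has at most
  `deg g_α < deg φ_a` elements (`eq_zero_of_pairing_eq_zero`).
* The `A`-modules `φ(L̄)` and `φ*(L̄)` are divisible, because `φ_a ≠ 0` for `a ≠ 0` and `L̄` is
  algebraically closed. Hence they are injective (`baer_of_divisible`).

The structure `CompatiblePairing` records these facts for two abstract modules `P` and `Q`, in a
form symmetric in `P` and `Q`. The compatibility rules show that `⟨α(b), β(a⁻¹)⟩_a` does not depend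
on the choice of `a` with `a b = 0`, and this defines the limit pairing. Its
`A_𝔮`-bilinearity is reduced to `A` by density: on a given torsion element of `K_𝔮/A_𝔮` an element
of `A_𝔮` acts as an element of `A`.

For perfectness (`CompatiblePairing.limit_bijective`) let `F` be an `A_𝔮`-linear map from
`Hom_A(K_𝔮/A_𝔮, Q)` to the dual of `K_𝔮/A_𝔮`, and let `b ∈ K_𝔮/A_𝔮` be killed by `𝔮ⁿ`. Choose `a`
of exact `𝔮`-adic valuation `n` outside `𝔭`. A homomorphism `β` with `β(a⁻¹) = 0` is divisible by
`a`, so `F(β)(b)` depends on `β(a⁻¹)` only; perfectness of `⟨ , ⟩_a` then gives a value `α(b)`, made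
unique by requiring it to be `𝔮`-primary. Injectivity of `Q` provides enough homomorphisms `β` for
uniqueness, and uniqueness makes `α` linear. Since `a` need not generate a power of `𝔮`, the
`𝔮`-primary part of the `a`-torsion has to be split off (`exists_projector`). The other half of
perfectness is the same statement with `P` and `Q` exchanged.

The description of the three modules as inverse limits says that `K_𝔮/A_𝔮` is the union of its
submodules `a⁻ⁿA/A` (`KmodA.exists_linearMap_smul_invClass_pow`).

Finally, let `μ₀` be an `F_q`-linear functional on `K_𝔮/A_𝔮` that does not vanish on the socle. As
the rings `A/𝔮ⁿ` are finite, `A_𝔮` is compact, and by a dimension count every functional agrees on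
the `𝔮ⁿ`-torsion with a multiple of `μ₀`. By compactness `s ↦ s μ₀` is a homeomorphism of `A_𝔮`
with the dual (`FqDual.nonempty_continuousLinearEquiv`).
-/

noncomputable section

namespace DrinfeldTate

/-! ### Linear polynomials and the pairing `⟨ , ⟩_f` -/

section Linear

variable {Fq : Type*} [Field Fq] [Fintype Fq] {F : Type*} [Field F] [Algebra Fq F]

variable (Fq) in
theorem exists_algebraMap_eq_of_pow_card_eq {x : F} (hx : x ^ Fintype.card Fq = x) :
    ∃ c : Fq, algebraMap Fq F c = x := by
  have h1 : (X ^ Fintype.card Fq - X : Fq[X]).roots = Finset.univ.val :=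
    FiniteField.roots_X_pow_card_sub_X Fq
  have hd : (X ^ Fintype.card Fq - X : Fq[X]).natDegree = Fintype.card Fq :=
    FiniteField.X_pow_card_sub_X_natDegree_eq Fq one_lt_q
  have hm : (X ^ Fintype.card Fq - X : Fq[X]).Monic := by
    refine monic_X_pow_sub ?_
    rw [degree_X]
    exact_mod_cast one_lt_q (Fq := Fq)
  have h2 := prod_multiset_X_sub_C_of_monic_of_roots_card_eq hm (by rw [h1, hd]; rfl)
  rw [h1] at h2
  have h3 := congrArg (aeval x) h2
  rw [map_sub, map_pow, aeval_X, hx, sub_self] at h3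
  change aeval x (∏ c : Fq, (X - C c)) = 0 at h3
  rw [map_prod, Finset.prod_eq_zero_iff] at h3
  obtain ⟨c, -, hc⟩ := h3
  rw [map_sub, aeval_X, aeval_C, sub_eq_zero] at hc
  exact ⟨c, hc.symm⟩

theorem isLinear_C_mul_X (c : F) : IsLinear Fq (C c * X) := by
  simpa using isLinear_monomial (Fq := Fq) c 0

theorem IsLinear.C_mul {f : F[X]} (hf : IsLinear Fq f) (c : F) : IsLinear Fq (C c * f) := by
  intro n hn
  refine hf n fun h => hn ?_
  rw [coeff_C_mul, h, mul_zero]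

theorem isLinear_X_sub_X_pow : IsLinear Fq (X - X ^ Fintype.card Fq : F[X]) := by
  have h0 : IsLinear Fq (X : F[X]) := by simpa using isLinear_C_mul_X (Fq := Fq) (1 : F)
  have h1 : IsLinear Fq (X ^ Fintype.card Fq : F[X]) := by
    simpa using isLinear_monomial (Fq := Fq) (1 : F) 1
  rw [sub_eq_add_neg]
  exact h0.add h1.neg

theorem IsLinear.comp_add {f : F[X]} (hf : IsLinear Fq f) (g h : F[X]) :
    f.comp (g + h) = f.comp g + f.comp h := by
  refine hf.induction (P := fun f => f.comp (g + h) = f.comp g + f.comp h) (by simp) ?_ ?_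
  · intro f₁ f₂ h1 h2
    simp only [add_comp, h1, h2]
    ring
  · intro c i
    simp only [mul_comp, C_comp, pow_comp, X_comp]
    rw [add_pow_q, mul_add]

theorem IsLinear.comp {f g : F[X]} (hf : IsLinear Fq f) (hg : IsLinear Fq g) :
    IsLinear Fq (f.comp g) := by
  refine hf.induction (P := fun f => IsLinear Fq (f.comp g)) ?_ ?_ ?_
  · intro n hn
    simp at hn
  · intro f₁ f₂ h1 h2
    rw [add_comp]
    exact h1.add h2
  · intro c i
    refine hg.induction
      (P := fun g => IsLinear Fq ((C c * X ^ Fintype.card Fq ^ i).comp g)) ?_ ?_ ?_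
    · intro n hn
      simp at hn
    · intro g₁ g₂ h1 h2
      rw [(isLinear_monomial (Fq := Fq) c i).comp_add]
      exact h1.add h2
    · intro d j
      simp only [mul_comp, C_comp, pow_comp, X_comp]
      rw [mul_pow, ← C_pow, ← mul_assoc, ← Polynomial.C_mul, ← pow_mul, ← pow_add]
      exact isLinear_monomial _ _

theorem IsLinear.map {f : F[X]} (hf : IsLinear Fq f) {E : Type*} [Field E] (σ : F →+* E) :
    IsLinear Fq (f.map σ) := by
  intro n hn
  refine hf n fun h => hn ?_
  rw [coeff_map, h, map_zero]

theorem IsLinear.comp_algebraMap_mul {f : F[X]} (hf : IsLinear Fq f) (c : Fq) (g : F[X]) :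
    f.comp (C (algebraMap Fq F c) * g) = C (algebraMap Fq F c) * f.comp g := by
  refine hf.induction (P := fun f => f.comp (C (algebraMap Fq F c) * g) =
    C (algebraMap Fq F c) * f.comp g) (by simp) ?_ ?_
  · intro f₁ f₂ h1 h2
    simp only [add_comp, h1, h2]
    ring
  · intro d i
    simp only [mul_comp, C_comp, pow_comp, X_comp]
    rw [mul_pow, ← C_pow, ← map_pow, FiniteField.pow_card_pow]
    ring

theorem IsLinear.eval_zero {f : F[X]} (hf : IsLinear Fq f) : f.eval 0 = 0 := by
  rw [← coeff_zero_eq_eval_zero]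
  by_contra h
  obtain ⟨i, hi⟩ := hf 0 h
  exact (pow_ne_zero i (Fintype.card_ne_zero (α := Fq))) hi.symm

theorem IsLinear.exists_natDegree_eq {f : F[X]} (hf : IsLinear Fq f) (h0 : f ≠ 0) :
    ∃ d, f.natDegree = Fintype.card Fq ^ d :=
  hf _ (by rwa [coeff_natDegree, leadingCoeff_ne_zero])

theorem cofactor_eq {f : F[X]} {α : F} {g : F[X]} (hg : IsCofactor Fq f α g) :
    cofactor Fq f α = g := by
  have h : ∃ g, IsCofactor Fq f α g := ⟨g, hg⟩
  rw [cofactor, dif_pos h]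
  exact comp_injective (Fq := Fq) (by rw [← h.choose_spec.2, hg.2])

section Pairing

variable [IsAlgClosed F]

theorem tau_inv_apply_eq_iff {x y : F} : (tau Fq F)⁻¹ x = y ↔ x = y ^ Fintype.card Fq := by
  rw [← tau_apply, ← (tau Fq F).injective.eq_iff, ← AlgEquiv.mul_apply, mul_inv_cancel,
    AlgEquiv.one_apply]

theorem adjoint_C_mul_X (c x : F) : adjoint Fq (C c * X) x = c * x := by
  simpa using adjoint_monomial (Fq := Fq) c 0 x

theorem adjoint_X_sub_X_pow (x : F) :
    adjoint Fq (X - X ^ Fintype.card Fq) x = x - (tau Fq F)⁻¹ x := by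
  have h : (X - X ^ Fintype.card Fq : F[X]) =
      C 1 * X + C (-1) * X ^ Fintype.card Fq ^ 1 := by
    simp [sub_eq_add_neg]
  rw [h, adjoint_add_left, adjoint_C_mul_X, adjoint_monomial]
  simp [sub_eq_add_neg]

/-- The pairing takes values in `F_q`: apply `adjoint_comp` to `f ∘ α = g_α ∘ (1 - τ)`. -/
theorem exists_algebraMap_eq_pairing {f : F[X]} (hf : IsLinear Fq f) {α β : F}
    (hα : f.eval α = 0) (hβ : adjoint Fq f β = 0) :
    ∃ c : Fq, algebraMap Fq F c = pairing Fq f α β := by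
  obtain ⟨hg, e⟩ := isCofactor_cofactor hf hα
  have h := congrArg (fun p => adjoint Fq p β) e
  rw [adjoint_comp hf (isLinear_C_mul_X α), adjoint_comp hg isLinear_X_sub_X_pow, hβ,
    adjoint_zero_right, adjoint_X_sub_X_pow, eq_comm, sub_eq_zero, eq_comm,
    tau_inv_apply_eq_iff] at h
  exact exists_algebraMap_eq_of_pow_card_eq Fq h.symm

theorem pairing_add_left {f : F[X]} (hf : IsLinear Fq f) {α α' : F} (hα : f.eval α = 0)
    (hα' : f.eval α' = 0) (β : F) :
    pairing Fq f (α + α') β = pairing Fq f α β + pairing Fq f α' β := by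
  obtain ⟨hg, e⟩ := isCofactor_cofactor hf hα
  obtain ⟨hg', e'⟩ := isCofactor_cofactor hf hα'
  have : cofactor Fq f (α + α') = cofactor Fq f α + cofactor Fq f α' :=
    cofactor_eq ⟨hg.add hg', by rw [C_add, add_mul, hf.comp_add, e, e', add_comp]⟩
  rw [pairing, this, adjoint_add_left, pairing, pairing]

theorem pairing_add_right (f : F[X]) (α β β' : F) :
    pairing Fq f α (β + β') = pairing Fq f α β + pairing Fq f α β' :=
  adjoint_add_right _ _ _

theorem adjoint_algebraMap_mul (f : F[X]) (c : Fq) (x : F) :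
    adjoint Fq f (algebraMap Fq F c * x) = algebraMap Fq F c * adjoint Fq f x := by
  simp only [adjoint, Finset.mul_sum]
  refine Finset.sum_congr rfl fun i _ => ?_
  rw [mul_left_comm, map_mul, AlgEquiv.commutes]

theorem pairing_algebraMap_mul_left {f : F[X]} (hf : IsLinear Fq f) {α : F} (hα : f.eval α = 0)
    (c : Fq) (β : F) :
    pairing Fq f (algebraMap Fq F c * α) β = algebraMap Fq F c * pairing Fq f α β := by
  obtain ⟨hg, e⟩ := isCofactor_cofactor hf hα
  have : cofactor Fq f (algebraMap Fq F c * α) = C (algebraMap Fq F c) * cofactor Fq f α :=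
    cofactor_eq ⟨hg.C_mul _, by rw [C_mul, mul_assoc, hf.comp_algebraMap_mul, e, mul_comp, C_comp]⟩
  have h2 : C (algebraMap Fq F c) * cofactor Fq f α =
      (C (algebraMap Fq F c) * X).comp (cofactor Fq f α) := by simp
  rw [pairing, this, h2, adjoint_comp (isLinear_C_mul_X _) hg, adjoint_C_mul_X,
    adjoint_algebraMap_mul, pairing]

/-- `⟨α, β⟩_{h f} = ⟨α, h* β⟩_f` for `α ∈ ker f`. -/
theorem pairing_comp_of_eval_eq_zero {f h : F[X]} (hf : IsLinear Fq f) (hh : IsLinear Fq h)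
    {α : F} (hα : f.eval α = 0) (β : F) :
    pairing Fq (h.comp f) α β = pairing Fq f α (adjoint Fq h β) := by
  obtain ⟨hg, e⟩ := isCofactor_cofactor hf hα
  have : cofactor Fq (h.comp f) α = h.comp (cofactor Fq f α) :=
    cofactor_eq ⟨hh.comp hg, by rw [comp_assoc, e, comp_assoc]⟩
  rw [pairing, this, adjoint_comp hh hg, pairing]

/-- `⟨α, β⟩_{f h} = ⟨h α, β⟩_f` for `β ∈ ker f*`. -/
theorem pairing_comp_of_adjoint_eq_zero {f h : F[X]} (hf : IsLinear Fq f) (hh : IsLinear Fq h)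
    {α β : F} (hα : f.eval (h.eval α) = 0) (hβ : adjoint Fq f β = 0) :
    pairing Fq (f.comp h) α β = pairing Fq f (h.eval α) β := by
  obtain ⟨hg, e⟩ := isCofactor_cofactor hf hα
  -- `h ∘ α - h(α)` vanishes at `1`, hence is right divisible by `1 - τ`.
  have hr : IsLinear Fq (h.comp (C α * X) - C (h.eval α) * X) := by
    rw [sub_eq_add_neg]
    exact (hh.comp (isLinear_C_mul_X α)).add (isLinear_C_mul_X _).neg
  have hr1 : (h.comp (C α * X) - C (h.eval α) * X).eval 1 = 0 := by simp [eval_comp]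
  obtain ⟨hk, ek⟩ := isCofactor_cofactor hr hr1
  set k := cofactor Fq (h.comp (C α * X) - C (h.eval α) * X) 1
  rw [C_1, one_mul, comp_X, sub_eq_iff_eq_add] at ek
  have : cofactor Fq (f.comp h) α = f.comp k + cofactor Fq f (h.eval α) :=
    cofactor_eq ⟨(hf.comp hk).add hg, by
      rw [comp_assoc, ek, hf.comp_add, e, add_comp, comp_assoc]⟩
  rw [pairing, this, adjoint_add_left, adjoint_comp hf hk, hβ, adjoint_zero_right, zero_add,
    pairing]

theorem adjoint_map_algEquiv {L : Type*} [Field L] [Algebra L F] (σ : F ≃ₐ[L] F) (f : F[X])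
    (x : F) : adjoint Fq (f.map (σ : F →+* F)) (σ x) = σ (adjoint Fq f x) := by
  have h1 : ∀ y, σ ((tau Fq F)⁻¹ y) = (tau Fq F)⁻¹ (σ y) := by
    intro y
    rw [eq_comm, tau_inv_apply_eq_iff, ← map_pow, ← tau_apply, ← AlgEquiv.mul_apply,
      mul_inv_cancel, AlgEquiv.one_apply]
  have h2 : ∀ (i : ℕ) (y), σ (((tau Fq F)⁻¹ ^ i) y) = ((tau Fq F)⁻¹ ^ i) (σ y) := by
    intro i
    induction i with
    | zero => intro y; simp
    | succ i ih => intro y; rw [pow_succ', AlgEquiv.mul_apply, h1, ih, AlgEquiv.mul_apply]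
  rw [adjoint, adjoint, map_sum, natDegree_map]
  refine Finset.sum_congr rfl fun i _ => ?_
  rw [h2, map_mul σ, coeff_map]
  rfl

/-- The pairing of a polynomial fixed by `σ` is `σ`-equivariant, since `g_{σ α}` is the image of
`g_α` under `σ`. -/
theorem pairing_map_apply {L : Type*} [Field L] [Algebra L F] (σ : F ≃ₐ[L] F) {f : F[X]}
    (hf : IsLinear Fq f) (hσ : f.map (σ : F →+* F) = f) {α : F} (hα : f.eval α = 0) (β : F) :
    pairing Fq f (σ α) (σ β) = σ (pairing Fq f α β) := by
  obtain ⟨hg, e⟩ := isCofactor_cofactor hf hα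
  have : cofactor Fq f (σ α) = (cofactor Fq f α).map (σ : F →+* F) := by
    refine cofactor_eq ⟨hg.map _, ?_⟩
    have := congrArg (Polynomial.map (σ : F →+* F)) e
    rw [Polynomial.map_comp, Polynomial.map_comp, hσ] at this
    simpa using this
  rw [pairing, this, adjoint_map_algEquiv, pairing]

end Pairing

/-! ### Counting: the pairing is perfect for separable `f` -/

section Counting

variable [IsAlgClosed F]

variable (Fq) in
/-- For `f = ∑_{i ≤ d} a_i τ^i`, the polynomial `∑ a_i^(q^(d-i)) τ^(d-i)`, whose values are the
`q^d`-th powers of those of the adjoint of `f`. -/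
def adjointPoly (f : F[X]) (d : ℕ) : F[X] :=
  ∑ i ∈ Finset.range (d + 1),
    C (f.coeff (Fintype.card Fq ^ i) ^ Fintype.card Fq ^ (d - i)) * X ^ Fintype.card Fq ^ (d - i)

theorem isLinear_adjointPoly (f : F[X]) (d : ℕ) : IsLinear Fq (adjointPoly Fq f d) :=
  IsLinear.sum _ _ fun _ _ => isLinear_monomial _ _

theorem coeff_adjointPoly (f : F[X]) {d i : ℕ} (hi : i ≤ d) :
    (adjointPoly Fq f d).coeff (Fintype.card Fq ^ (d - i)) =
      f.coeff (Fintype.card Fq ^ i) ^ Fintype.card Fq ^ (d - i) := by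
  rw [adjointPoly, finsetSum_coeff, Finset.sum_eq_single i]
  · rw [coeff_C_mul, coeff_X_pow_self, mul_one]
  · intro j hj hji
    rw [coeff_C_mul, coeff_X_pow, if_neg, mul_zero]
    intro e
    have := Nat.pow_right_injective (one_lt_q (Fq := Fq)) e
    rw [Finset.mem_range] at hj
    omega
  · intro h
    exact absurd (Finset.mem_range.mpr (Nat.lt_succ_of_le hi)) h

theorem natDegree_adjointPoly_le (f : F[X]) (d : ℕ) :
    (adjointPoly Fq f d).natDegree ≤ Fintype.card Fq ^ d := by
  refine natDegree_sum_le_of_forall_le _ _ fun i _ => (natDegree_C_mul_X_pow_le _ _).trans ?_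
  exact Nat.pow_le_pow_right Fintype.card_pos (Nat.sub_le d i)

theorem eval_adjointPoly {f : F[X]} {d : ℕ} (hd : f.natDegree = Fintype.card Fq ^ d) (x : F) :
    (adjointPoly Fq f d).eval x = (tau Fq F ^ d) (adjoint Fq f x) := by
  have h1 : adjoint Fq f x = ∑ i ∈ Finset.range (d + 1),
      ((tau Fq F)⁻¹ ^ i) (f.coeff (Fintype.card Fq ^ i) * x) := by
    symm
    refine Finset.sum_subset (Finset.range_mono ?_) fun i _ hi => ?_
    · rw [hd]
      exact Nat.succ_le_succ (Nat.lt_pow_self one_lt_q).le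
    · rw [coeff_eq_zero_of_natDegree_lt, zero_mul, map_zero]
      rw [hd]
      rw [Finset.mem_range] at hi
      exact Nat.pow_lt_pow_right one_lt_q (by omega)
  rw [h1, map_sum, adjointPoly, eval_finsetSum]
  refine Finset.sum_congr rfl fun i hi => ?_
  have hid : d = (d - i) + i := by
    rw [Finset.mem_range] at hi
    omega
  have h2 : tau Fq F ^ d * (tau Fq F)⁻¹ ^ i = tau Fq F ^ (d - i) := by
    conv_lhs => rw [hid]
    rw [pow_add, mul_assoc, inv_pow, mul_inv_cancel, mul_one]
  rw [← AlgEquiv.mul_apply, h2, tau_pow_apply, mul_pow]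
  simp

theorem adjointPoly_ne_zero {f : F[X]} {d : ℕ} (hd : f.natDegree = Fintype.card Fq ^ d) :
    adjointPoly Fq f d ≠ 0 := by
  have hf0 : f ≠ 0 := by
    rintro rfl
    exact (pow_ne_zero d (Fintype.card_ne_zero (α := Fq))) hd.symm
  intro h
  have := coeff_adjointPoly (Fq := Fq) f (le_refl d)
  rw [h, coeff_zero, eq_comm] at this
  exact hf0 (leadingCoeff_eq_zero.mp (by
    rw [leadingCoeff, hd]
    exact eq_zero_of_pow_eq_zero this))

theorem adjoint_eq_zero_iff_isRoot {f : F[X]} {d : ℕ} (hd : f.natDegree = Fintype.card Fq ^ d)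
    (x : F) : adjoint Fq f x = 0 ↔ (adjointPoly Fq f d).IsRoot x := by
  rw [IsRoot, eval_adjointPoly hd, map_eq_zero_iff _ (tau Fq F ^ d).injective]

theorem setOf_adjoint_eq_zero {f : F[X]} {d : ℕ} (hd : f.natDegree = Fintype.card Fq ^ d) :
    {x : F | adjoint Fq f x = 0} = (adjointPoly Fq f d).rootSet F := by
  ext x
  rw [Set.mem_ofPred_eq, adjoint_eq_zero_iff_isRoot hd, mem_rootSet, coe_aeval_eq_eval]
  exact ⟨fun h => ⟨adjointPoly_ne_zero hd, h⟩, fun h => h.2⟩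

theorem finite_setOf_adjoint_eq_zero {f : F[X]} (hf : IsLinear Fq f) (h0 : f ≠ 0) :
    {x : F | adjoint Fq f x = 0}.Finite := by
  obtain ⟨d, hd⟩ := hf.exists_natDegree_eq h0
  rw [setOf_adjoint_eq_zero hd]
  exact rootSet_finite _ _

theorem ncard_rootSet_le (p : F[X]) : (p.rootSet F).ncard ≤ p.natDegree := by
  classical
  rw [rootSet_def, Set.ncard_coe_finset]
  exact (Multiset.toFinset_card_le _).trans ((card_roots' _).trans (natDegree_map_le))

theorem ncard_adjoint_eq_zero_le {f : F[X]} (hf : IsLinear Fq f) (h0 : f ≠ 0) :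
    {x : F | adjoint Fq f x = 0}.ncard ≤ f.natDegree := by
  obtain ⟨d, hd⟩ := hf.exists_natDegree_eq h0
  rw [setOf_adjoint_eq_zero hd, hd]
  exact (ncard_rootSet_le _).trans (natDegree_adjointPoly_le f d)

/-- A linear polynomial with nonzero linear coefficient is separable: its derivative is a
nonzero constant. -/
theorem IsLinear.separable {f : F[X]} (hf : IsLinear Fq f) (h1 : f.coeff 1 ≠ 0) :
    f.Separable := by
  have hq : ((Fintype.card Fq : ℕ) : F) = 0 := by
    rw [← map_natCast (algebraMap Fq F), FiniteField.cast_card_eq_zero, map_zero]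
  have : derivative f = C (f.coeff 1) := by
    ext n
    rw [coeff_derivative, coeff_C]
    split_ifs with h
    · simp [h]
    · by_cases hn : f.coeff (n + 1) = 0
      · rw [hn, zero_mul]
      · obtain ⟨i, hi⟩ := hf _ hn
        have hi0 : i ≠ 0 := by
          rintro rfl
          rw [pow_zero] at hi
          omega
        have : ((n : F) + 1) = 0 := by
          rw [← Nat.cast_succ, Nat.succ_eq_add_one, hi, Nat.cast_pow, hq, zero_pow hi0]
        rw [this, mul_zero]
  rw [separable_def, this]
  exact (isCoprime_one_right (x := f)).of_isCoprime_of_dvd_right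
    (isUnit_C.mpr h1.isUnit).dvd

theorem IsLinear.ncard_rootSet {f : F[X]} (hf : IsLinear Fq f) (h1 : f.coeff 1 ≠ 0) :
    (f.rootSet F).ncard = f.natDegree := by
  rw [← card_rootSet_eq_natDegree (K := F) (hf.separable h1) (IsAlgClosed.splits _),
    ← Nat.card_coe_set_eq, Nat.card_eq_fintype_card]

theorem IsLinear.ncard_eval_eq_zero {f : F[X]} (hf : IsLinear Fq f) (h1 : f.coeff 1 ≠ 0) :
    {x : F | f.eval x = 0}.ncard = f.natDegree := by
  have hf0 : f ≠ 0 := by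
    rintro rfl
    exact h1 (coeff_zero 1)
  rw [← hf.ncard_rootSet h1]
  congr 1
  ext x
  rw [Set.mem_ofPred_eq, mem_rootSet, coe_aeval_eq_eval]
  exact ⟨fun h => ⟨hf0, h⟩, fun h => h.2⟩

/-- The reversed polynomial `adjointPoly` has the same degree as `f`, and its linear coefficient is
the leading coefficient of `f`, so it is separable too. -/
theorem IsLinear.ncard_adjoint_eq_zero {f : F[X]} (hf : IsLinear Fq f) (h1 : f.coeff 1 ≠ 0) :
    {x : F | adjoint Fq f x = 0}.ncard = f.natDegree := by
  have hf0 : f ≠ 0 := by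
    rintro rfl
    exact h1 (coeff_zero 1)
  obtain ⟨d, hd⟩ := hf.exists_natDegree_eq hf0
  have c1 := coeff_adjointPoly (Fq := Fq) f (le_refl d)
  have c2 := coeff_adjointPoly (Fq := Fq) f (Nat.zero_le d)
  simp only [Nat.sub_self, pow_zero, pow_one, Nat.sub_zero] at c1 c2
  rw [setOf_adjoint_eq_zero hd, (isLinear_adjointPoly f d).ncard_rootSet]
  · rw [hd]
    refine le_antisymm (natDegree_adjointPoly_le f d) (le_natDegree_of_ne_zero ?_)
    rw [c2]
    exact pow_ne_zero _ h1
  · rw [c1, ← hd, coeff_natDegree]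
    exact leadingCoeff_ne_zero.mpr hf0

/-- Left nondegeneracy: for `α ≠ 0` the map `g_α*` has fewer zeros than `f*`, because `g_α` has
smaller degree than `f`. -/
theorem eq_zero_of_pairing_eq_zero {f : F[X]} (hf : IsLinear Fq f) (h1 : f.coeff 1 ≠ 0) {α : F}
    (hα : f.eval α = 0) (h : ∀ β, adjoint Fq f β = 0 → pairing Fq f α β = 0) : α = 0 := by
  by_contra hα0
  have hf0 : f ≠ 0 := by
    rintro rfl
    exact h1 (coeff_zero 1)
  obtain ⟨hg, e⟩ := isCofactor_cofactor hf hα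
  have hdeg := congrArg natDegree e
  have hX : (X - X ^ Fintype.card Fq : F[X]).natDegree = Fintype.card Fq := by
    rw [← neg_sub, natDegree_neg]
    exact FiniteField.X_pow_card_sub_X_natDegree_eq F one_lt_q
  rw [natDegree_comp, natDegree_comp, natDegree_C_mul_X α hα0, hX, mul_one] at hdeg
  have hfd : 0 < f.natDegree := by
    obtain ⟨d, hd⟩ := hf.exists_natDegree_eq hf0
    rw [hd]
    exact pow_pos Fintype.card_pos d
  have hg0 : cofactor Fq f α ≠ 0 := by
    intro h0
    rw [h0, natDegree_zero, zero_mul] at hdeg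
    omega
  have hle : f.natDegree ≤ (cofactor Fq f α).natDegree := by
    rw [← hf.ncard_adjoint_eq_zero h1]
    exact (Set.ncard_le_ncard h (finite_setOf_adjoint_eq_zero hg hg0)).trans
      (ncard_adjoint_eq_zero_le hg hg0)
  have hq := one_lt_q (Fq := Fq)
  nlinarith

theorem IsLinear.exists_eval_eq {f : F[X]} (hf : IsLinear Fq f) (h0 : f ≠ 0) (y : F) :
    ∃ x, f.eval x = y := by
  have hd : 0 < f.natDegree := by
    obtain ⟨d, hd⟩ := hf.exists_natDegree_eq h0
    rw [hd]
    exact pow_pos Fintype.card_pos d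
  obtain ⟨x, hx⟩ := IsAlgClosed.exists_root (f - C y) (by
    rw [degree_sub_C (natDegree_pos_iff_degree_pos.mp hd)]
    exact (natDegree_pos_iff_degree_pos.mp hd).ne')
  exact ⟨x, by simpa [IsRoot, sub_eq_zero] using hx⟩

theorem IsLinear.exists_adjoint_eq {f : F[X]} (hf : IsLinear Fq f) (h0 : f ≠ 0) (y : F) :
    ∃ x, adjoint Fq f x = y := by
  obtain ⟨d, hd⟩ := hf.exists_natDegree_eq h0
  obtain ⟨x, hx⟩ := (isLinear_adjointPoly (Fq := Fq) f d).exists_eval_eq (adjointPoly_ne_zero hd)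
    ((tau Fq F ^ d) y)
  rw [eval_adjointPoly hd] at hx
  exact ⟨x, (tau Fq F ^ d).injective hx⟩

end Counting

end Linear

/-! ### The module `K_𝔮 / A_𝔮` -/

section KmodA

open WithZero

variable {A : Type*} [CommRing A] [IsDedekindDomain A]

/-- An element of exact `𝔮`-adic valuation `n` outside a prime `𝔭 ≠ 𝔮`. -/
theorem exists_mem_pow_not_mem_pow_succ_not_mem (v : HeightOneSpectrum A) (p : Ideal A)
    [p.IsPrime] (hp : v.asIdeal ≠ p) (n : ℕ) :
    ∃ a ∈ v.asIdeal ^ n, a ∉ v.asIdeal ^ (n + 1) ∧ a ∉ p := by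
  obtain ⟨a, ha, ha'⟩ := SetLike.exists_of_lt
    (Ideal.pow_succ_lt_pow (P := v.asIdeal) v.ne_bot n)
  by_cases hap : a ∈ p
  · have hle : ¬ v.asIdeal ^ (n + 1) ≤ p := fun h =>
      hp (v.isMaximal.eq_of_le (Ideal.IsPrime.ne_top ‹_›) (Ideal.IsPrime.le_of_pow_le h))
    obtain ⟨e, he, hep⟩ := Set.not_subset.mp hle
    refine ⟨a + e, add_mem ha (Ideal.pow_le_pow_right n.le_succ he), fun h => ha' ?_,
      fun h => hep ?_⟩
    · simpa using sub_mem h he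
    · simpa using sub_mem h hap
  · exact ⟨a, ha, ha', hap⟩

theorem intValuation_eq_exp_neg {v : HeightOneSpectrum A} {a : A} {n : ℕ}
    (ha : a ∈ v.asIdeal ^ n) (ha' : a ∉ v.asIdeal ^ (n + 1)) :
    v.intValuation a = exp (-(n : ℤ)) := by
  refine le_antisymm ((v.intValuation_le_pow_iff_mem a n).mpr ha) ?_
  rw [← v.intValuation_le_pow_iff_mem, not_le, Nat.cast_succ, neg_add] at ha'
  have h0 : v.intValuation a ≠ 0 := (lt_of_le_of_lt (_root_.zero_le) ha').ne'
  rw [← exp_log h0, exp_lt_exp] at ha'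
  rw [← exp_log h0, exp_le_exp]
  omega

variable {K : Type*} [Field K] [Algebra A K] [IsFractionRing A K] {v : HeightOneSpectrum A}

theorem valued_algebraMap (a : A) :
    Valued.v (algebraMap A (v.adicCompletion K) a) = v.intValuation a := by
  have := v.valuedAdicCompletion_eq_valuation (K := K) a
  rw [v.valuation_of_algebraMap] at this
  exact this

theorem algebraMap_ne_zero {a : A} (ha : a ≠ 0) : algebraMap A (v.adicCompletion K) a ≠ 0 := by
  intro h
  have := valued_algebraMap (K := K) (v := v) a
  rw [h, map_zero] at this
  exact v.intValuation_ne_zero a ha this.symm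

namespace KmodA

variable (K v) in
/-- The class in `K_𝔮 / A_𝔮` of an element of `K_𝔮`. -/
def mk (x : v.adicCompletion K) : KmodA K v := Submodule.Quotient.mk x

theorem mk_surjective : Function.Surjective (mk K v) := Submodule.Quotient.mk_surjective _

theorem mk_eq_zero_iff (x : v.adicCompletion K) : mk K v x = 0 ↔ Valued.v x ≤ 1 := by
  rw [mk, Submodule.Quotient.mk_eq_zero, LinearMap.mem_range,
    ← HeightOneSpectrum.mem_adicCompletionIntegers A K v]
  exact ⟨by rintro ⟨s, rfl⟩; exact s.2, fun h => ⟨⟨x, h⟩, rfl⟩⟩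

theorem mk_sub (x y : v.adicCompletion K) : mk K v (x - y) = mk K v x - mk K v y := rfl

theorem smul_mk (a : A) (x : v.adicCompletion K) :
    a • mk K v x = mk K v (algebraMap A (v.adicCompletion K) a * x) := by
  rw [← Algebra.smul_def]
  rfl

theorem integers_smul_mk (s : v.adicCompletionIntegers K) (x : v.adicCompletion K) :
    s • mk K v x = mk K v (s * x) := rfl

theorem invClass_eq_mk (a : A) :
    invClass K v a = mk K v (algebraMap A (v.adicCompletion K) a)⁻¹ := rfl

theorem algebraMap_smul_eq (a : A) (b : KmodA K v) :
    algebraMap A (v.adicCompletionIntegers K) a • b = a • b :=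
  algebraMap_smul _ _ _

theorem exists_smul_eq {a : A} (ha : a ≠ 0) (b : KmodA K v) : ∃ b', a • b' = b := by
  obtain ⟨x, rfl⟩ := mk_surjective b
  exact ⟨mk K v ((algebraMap A (v.adicCompletion K) a)⁻¹ * x), by
    rw [smul_mk, mul_inv_cancel_left₀ (algebraMap_ne_zero ha)]⟩

theorem smul_invClass_eq_zero_iff {a : A} (ha : a ≠ 0) (c : A) :
    c • invClass K v a = 0 ↔ v.intValuation c ≤ v.intValuation a := by
  rw [invClass_eq_mk, smul_mk, mk_eq_zero_iff, map_mul, map_inv₀, valued_algebraMap,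
    valued_algebraMap, ← div_eq_mul_inv, div_le_one₀]
  exact zero_lt_iff.mpr (v.intValuation_ne_zero a ha)

theorem smul_invClass_eq_zero_iff_mem_pow {a : A} {n : ℕ} (ha : a ∈ v.asIdeal ^ n)
    (ha' : a ∉ v.asIdeal ^ (n + 1)) (c : A) :
    c • invClass K v a = 0 ↔ c ∈ v.asIdeal ^ n := by
  have h0 : a ≠ 0 := by
    rintro rfl
    exact ha' (zero_mem _)
  rw [smul_invClass_eq_zero_iff h0, intValuation_eq_exp_neg ha ha', v.intValuation_le_pow_iff_mem]

theorem smul_invClass_self (a : A) : a • invClass K v a = 0 := by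
  rcases eq_or_ne a 0 with rfl | ha
  · rw [zero_smul]
  · exact (smul_invClass_eq_zero_iff ha a).mpr le_rfl

theorem smul_invClass_mul (a : A) {c : A} (hc : c ≠ 0) :
    c • invClass K v (a * c) = invClass K v a := by
  rw [invClass_eq_mk, invClass_eq_mk, smul_mk, map_mul, mul_inv, mul_left_comm,
    mul_inv_cancel₀ (algebraMap_ne_zero hc), mul_one]

theorem isOpen_valued_le {z : v.adicCompletion K} (hz : z ≠ 0) :
    IsOpen {y : v.adicCompletion K | Valued.v y ≤ Valued.v z} := by
  have h := (Valued.isOpen_integer (v.adicCompletion K)).preimage (continuous_mul_const z⁻¹)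
  convert! h using 1
  ext y
  rw [Set.mem_ofPred_eq, Set.mem_preimage, SetLike.mem_coe, Valuation.mem_integer_iff, map_mul,
    map_inv₀, ← div_eq_mul_inv, div_le_one₀ (zero_lt_iff.mpr ((Valuation.ne_zero_iff _).mpr hz))]

variable (K v) in
theorem exists_valued_eq_exp_neg (n : ℕ) : ∃ a : A, a ≠ 0 ∧
    Valued.v (algebraMap A (v.adicCompletion K) a) = exp (-(n : ℤ)) := by
  obtain ⟨a, ha, ha'⟩ := SetLike.exists_of_lt
    (Ideal.pow_succ_lt_pow (P := v.asIdeal) v.ne_bot n)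
  refine ⟨a, ?_, by rw [valued_algebraMap, intValuation_eq_exp_neg ha ha']⟩
  rintro rfl
  exact ha' (zero_mem _)

/-- `A` is dense in `A_𝔮`. -/
theorem exists_valued_sub_le (s : v.adicCompletionIntegers K) (n : ℕ) :
    ∃ c : A, Valued.v ((s : v.adicCompletion K) - algebraMap A (v.adicCompletion K) c) ≤
      exp (-(n : ℤ)) := by
  obtain ⟨a, ha, hva⟩ := exists_valued_eq_exp_neg K v n
  have hopen : IsOpen {y : v.adicCompletion K | Valued.v ((s : v.adicCompletion K) - y) ≤
      exp (-(n : ℤ))} := by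
    rw [← hva]
    exact (isOpen_valued_le (algebraMap_ne_zero ha)).preimage
      (f := fun y : v.adicCompletion K => (s : v.adicCompletion K) - y) (by fun_prop)
  obtain ⟨k, hk⟩ := (v.denseRange_algebraMap K).exists_mem_open hopen
    ⟨s, by rw [Set.mem_ofPred_eq, sub_self, map_zero]; exact _root_.zero_le⟩
  have hk' : Valued.v ((s : v.adicCompletion K) - algebraMap K (v.adicCompletion K) k) ≤
      exp (-(n : ℤ)) := hk
  have hvk : ∀ k : K, Valued.v (algebraMap K (v.adicCompletion K) k) = v.valuation K k :=
    fun k => v.valuedAdicCompletion_eq_valuation' k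
  have hexp : (exp (-(n : ℤ)) : ℤᵐ⁰) ≤ 1 := by
    rw [← exp_zero, exp_le_exp]
    omega
  have hk1 : v.valuation K k ≤ 1 := by
    rw [← hvk, ← sub_sub_cancel (s : v.adicCompletion K) (algebraMap K (v.adicCompletion K) k)]
    exact (Valuation.map_sub _ _ _).trans (max_le s.2 (hk'.trans hexp))
  obtain ⟨c, hc⟩ := v.exists_valuation_sub_lt_of_integer hk1
    (Units.mk0 (exp (-(n : ℤ))) exp_ne_zero)
  refine ⟨c, ?_⟩
  rw [← sub_add_sub_cancel _ (algebraMap K (v.adicCompletion K) k)]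
  refine (Valuation.map_add _ _ _).trans (max_le hk' ?_)
  rw [IsScalarTower.algebraMap_apply A K (v.adicCompletion K), ← map_sub, hvk,
    Valuation.map_sub_swap]
  exact hc.le

/-- Every element of `K_𝔮 / A_𝔮` is killed by a power of `𝔮`. -/
theorem exists_pow_smul_eq_zero (b : KmodA K v) : ∃ n : ℕ, ∀ d ∈ v.asIdeal ^ n, d • b = 0 := by
  obtain ⟨x, rfl⟩ := mk_surjective b
  refine ⟨(log (Valued.v x)).toNat, fun d hd => ?_⟩
  rw [smul_mk, mk_eq_zero_iff, map_mul, valued_algebraMap]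
  rw [← v.intValuation_le_pow_iff_mem] at hd
  have hx : Valued.v x ≤ exp ((log (Valued.v x)).toNat : ℤ) :=
    le_exp_log.trans (exp_le_exp.mpr (Int.self_le_toNat _))
  calc v.intValuation d * Valued.v x ≤ exp (-((log (Valued.v x)).toNat : ℤ)) *
        exp ((log (Valued.v x)).toNat : ℤ) := mul_le_mul' hd hx
    _ = 1 := by rw [← exp_add, neg_add_cancel, exp_zero]

/-- On the elements killed by `𝔮 ^ n`, an element of `A_𝔮` acts as an element of `A`. -/
theorem exists_smul_eq_smul (s : v.adicCompletionIntegers K) (n : ℕ) :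
    ∃ c : A, ∀ b : KmodA K v, (∀ d ∈ v.asIdeal ^ n, d • b = 0) → s • b = c • b := by
  obtain ⟨c, hc⟩ := exists_valued_sub_le s n
  refine ⟨c, fun b hb => ?_⟩
  obtain ⟨a, ha, ha'⟩ := SetLike.exists_of_lt
    (Ideal.pow_succ_lt_pow (P := v.asIdeal) v.ne_bot n)
  have hb' := hb a ha
  obtain ⟨x, rfl⟩ := mk_surjective b
  rw [smul_mk, mk_eq_zero_iff, map_mul, valued_algebraMap, intValuation_eq_exp_neg ha ha'] at hb'
  rw [integers_smul_mk, smul_mk, ← sub_eq_zero, ← mk_sub, ← sub_mul, mk_eq_zero_iff, map_mul]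
  exact (mul_le_mul_left hc _).trans hb'

/-- The `a`-torsion of `K_𝔮 / A_𝔮` is generated by the class of `a⁻¹`. -/
theorem exists_smul_invClass_eq {a : A} (ha : a ≠ 0) {b : KmodA K v} (hb : a • b = 0) :
    ∃ c : A, c • invClass K v a = b := by
  obtain ⟨x, rfl⟩ := mk_surjective b
  rw [smul_mk, mk_eq_zero_iff] at hb
  obtain ⟨c, hc⟩ := exists_valued_sub_le (K := K) (v := v)
    ⟨_, hb⟩ (-log (v.intValuation a)).toNat
  have h0 := v.intValuation_ne_zero a ha
  refine ⟨c, ?_⟩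
  rw [eq_comm, ← sub_eq_zero, invClass_eq_mk, smul_mk, ← mk_sub, mk_eq_zero_iff]
  have e : x - algebraMap A (v.adicCompletion K) c * (algebraMap A (v.adicCompletion K) a)⁻¹ =
      (algebraMap A (v.adicCompletion K) a * x - algebraMap A (v.adicCompletion K) c) *
        (algebraMap A (v.adicCompletion K) a)⁻¹ := by
    rw [sub_mul, mul_comm _ x, mul_inv_cancel_right₀ (algebraMap_ne_zero ha)]
  rw [e, map_mul, map_inv₀, valued_algebraMap, ← div_eq_mul_inv, div_le_one₀ (zero_lt_iff.mpr h0)]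
  refine hc.trans ?_
  rw [← exp_log h0, exp_le_exp, log_exp]
  have := Int.self_le_toNat (-log (v.intValuation a))
  omega

end KmodA

end KmodA

/-! ### Divisible modules over a Dedekind domain -/

section Baer

open scoped nonZeroDivisors

variable {A : Type*} [CommRing A] [IsDedekindDomain A] {Q : Type*} [AddCommGroup Q] [Module A Q]

/-- Over a Dedekind domain divisible modules are injective. Writing `1 = ∑ cᵢ bᵢ` with `cᵢ ∈ I` and
`bᵢ ∈ I⁻¹`, and choosing `qᵢ` with `cᵢ qᵢ = g cᵢ`, the map `g : I → Q` is multiplication by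
`∑ (bᵢ cᵢ) qᵢ`. -/
theorem baer_of_divisible (h : ∀ a : A, a ≠ 0 → ∀ y : Q, ∃ x, a • x = y) : Module.Baer A Q := by
  intro I g
  rcases eq_or_ne I ⊥ with rfl | hI
  · refine ⟨0, fun x hx => ?_⟩
    have : (⟨x, hx⟩ : (⊥ : Ideal A)) = 0 := Subtype.ext hx
    rw [this, map_zero]
    rfl
  have key : ∀ r ∈ ((I : FractionalIdeal A⁰ (FractionRing A)) : Submodule A (FractionRing A)) *
      (((I : FractionalIdeal A⁰ (FractionRing A))⁻¹ : FractionalIdeal A⁰ (FractionRing A)) :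
        Submodule A (FractionRing A)),
      ∃ r₀ : A, algebraMap A (FractionRing A) r₀ = r ∧
        ∃ q : Q, ∀ x : I, r₀ • g x = (x : A) • q := by
    intro r hr
    refine Submodule.mul_induction_on hr ?_ ?_
    · intro c hc b hb
      obtain ⟨c, hcI, rfl⟩ := (FractionalIdeal.mem_coeIdeal _).mp hc
      have hbI : ∀ y ∈ I, ∃ z : A, algebraMap A (FractionRing A) z =
          b * algebraMap A (FractionRing A) y := by
        intro y hy
        have := (FractionalIdeal.mem_inv_iff (FractionalIdeal.coeIdeal_ne_zero.mpr hI)).mp hb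
          _ (FractionalIdeal.mem_coeIdeal_of_mem _ hy)
        exact (FractionalIdeal.mem_one_iff _).mp this
      obtain ⟨r₀, hr₀⟩ := hbI c hcI
      refine ⟨r₀, by rw [hr₀, mul_comm], ?_⟩
      obtain ⟨q, hq⟩ : ∃ q : Q, c • q = g ⟨c, hcI⟩ := by
        rcases eq_or_ne c 0 with rfl | hc0
        · refine ⟨0, ?_⟩
          have : (⟨0, hcI⟩ : I) = 0 := rfl
          rw [this, map_zero, smul_zero]
        · exact h c hc0 _
      refine ⟨r₀ • q, fun x => ?_⟩
      obtain ⟨z, hz⟩ := hbI x x.2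
      have e1 : r₀ * x = z * c := by
        apply IsFractionRing.injective A (FractionRing A)
        rw [map_mul, map_mul, hr₀, hz]
        ring
      have e2 : r₀ • x = z • (⟨c, hcI⟩ : I) := Subtype.ext e1
      rw [← map_smul, e2, map_smul, ← hq, smul_smul, smul_smul, ← e1, mul_comm]
    · rintro _ _ ⟨r₀, rfl, q, hq⟩ ⟨r₁, rfl, q', hq'⟩
      exact ⟨r₀ + r₁, map_add _ _ _, q + q', fun x => by rw [add_smul, hq, hq', smul_add]⟩
  obtain ⟨r₀, hr₀, q, hq⟩ := key 1 (by
    rw [← FractionalIdeal.coe_mul, mul_inv_cancel₀ (FractionalIdeal.coeIdeal_ne_zero.mpr hI)]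
    exact (FractionalIdeal.mem_one_iff _).mpr ⟨1, map_one _⟩)
  have h1 : r₀ = 1 := by
    apply IsFractionRing.injective A (FractionRing A)
    rw [hr₀, map_one]
  subst h1
  refine ⟨LinearMap.toSpanSingleton A Q q, fun x hx => ?_⟩
  rw [LinearMap.toSpanSingleton_apply, ← hq ⟨x, hx⟩, one_smul]

end Baer

/-! ### Homomorphisms out of `K_𝔮 / A_𝔮` -/

section Hom

variable {A : Type*} [CommRing A] [IsDedekindDomain A] {K : Type*} [Field K] [Algebra A K]
  [IsFractionRing A K] {v : HeightOneSpectrum A} {Q : Type*} [AddCommGroup Q] [Module A Q]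

namespace HomKmodA

/-- A linear map on `K_𝔮 / A_𝔮`, as an element of `HomKmodA`. -/
def ofLinearMap {S : Type*} [CommRing S] [Module S (KmodA K v)] {N : Type*} [AddCommGroup N]
    [Module S N] (f : KmodA K v →ₗ[S] N) : HomKmodA K v S N := f

theorem ofLinearMap_apply {S : Type*} [CommRing S] [Module S (KmodA K v)] {N : Type*}
    [AddCommGroup N] [Module S N] (f : KmodA K v →ₗ[S] N) (b : KmodA K v) :
    ofLinearMap f b = f b := rfl

theorem add_apply {S : Type*} [CommRing S] [Module S (KmodA K v)] {N : Type*} [AddCommGroup N]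
    [Module S N] (f g : HomKmodA K v S N) (b : KmodA K v) : (f + g) b = f b + g b := rfl

theorem algebraMap_smul_apply (a : A) (f : HomKmodA K v A Q) (b : KmodA K v) :
    (algebraMap A (v.adicCompletionIntegers K) a • f) b = a • f b := by
  rw [smul_apply, KmodA.algebraMap_smul_eq, map_smul]

section Topology

variable {S : Type*} [CommRing S] [Module S (KmodA K v)] {N : Type*} [AddCommGroup N] [Module S N]

theorem isOpen_setOf_apply_eq (b : KmodA K v) (y : N) :
    IsOpen {f : HomKmodA K v S N | f b = y} := by
  refine ⟨{g | g b = y}, ?_, rfl⟩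
  let _ : TopologicalSpace N := ⊥
  have : DiscreteTopology N := ⟨rfl⟩
  exact (isOpen_discrete {y}).preimage (continuous_apply (A := fun _ : KmodA K v => N) b)

theorem continuous_of_locally_const {X : Type*} [TopologicalSpace X] {g : X → HomKmodA K v S N}
    (h : ∀ b x, ∃ U, IsOpen U ∧ x ∈ U ∧ ∀ y ∈ U, g y b = g x b) : Continuous g := by
  refine continuous_induced_rng.mpr ?_
  let _ : TopologicalSpace N := ⊥
  refine continuous_pi fun b => continuous_def.mpr fun s _ => isOpen_iff_forall_mem_open.mpr ?_
  intro x hx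
  obtain ⟨U, hU, hxU, hUx⟩ := h b x
  refine ⟨U, fun y hy => ?_, hU, hxU⟩
  change g y b ∈ s
  rw [hUx y hy]
  exact hx

instance : T2Space (HomKmodA K v S N) := by
  let _ : TopologicalSpace N := ⊥
  have : DiscreteTopology N := ⟨rfl⟩
  exact T2Space.of_injective_continuous (f := fun (f : HomKmodA K v S N) (b : KmodA K v) => f b)
    DFunLike.coe_injective continuous_induced_dom

end Topology

/-- If `Q` is injective, every element of `Q` satisfying the relations of `b` is the value at `b` of
some homomorphism. -/
theorem exists_apply_eq (hQ : Module.Baer A Q) {b : KmodA K v} {y : Q}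
    (h : ∀ c : A, c • b = 0 → c • y = 0) : ∃ f : HomKmodA K v A Q, f b = y := by
  let t := LinearMap.toSpanSingleton A (KmodA K v) b
  have hi : Function.Injective (t.ker.liftQ t le_rfl) :=
    LinearMap.ker_eq_bot.mp (Submodule.ker_liftQ_eq_bot _ _ _ le_rfl)
  have hg : t.ker ≤ (LinearMap.toSpanSingleton A Q y).ker := fun c hc => h c hc
  obtain ⟨f, hf⟩ := hQ.extension_property (t.ker.liftQ t le_rfl) hi
    (t.ker.liftQ (LinearMap.toSpanSingleton A Q y) hg)
  refine ⟨ofLinearMap f, ?_⟩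
  have : f (t 1) = LinearMap.toSpanSingleton A Q y 1 := LinearMap.congr_fun hf (t.ker.mkQ 1)
  rwa [LinearMap.toSpanSingleton_apply, LinearMap.toSpanSingleton_apply, one_smul, one_smul] at this

/-- A homomorphism vanishing at the class of `a⁻¹` is divisible by `a`. -/
theorem exists_smul_eq_of_apply_invClass {a : A} (ha : a ≠ 0) {f : HomKmodA K v A Q}
    (hf : f (invClass K v a) = 0) :
    ∃ f' : HomKmodA K v A Q, algebraMap A (v.adicCompletionIntegers K) a • f' = f := by
  let g : KmodA K v →ₗ[A] KmodA K v := LinearMap.lsmul A (KmodA K v) a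
  have hg : Function.Surjective g := KmodA.exists_smul_eq ha
  let f₀ : KmodA K v →ₗ[A] Q := f
  have hker : g.ker ≤ f₀.ker := by
    intro b hb
    obtain ⟨c, rfl⟩ := KmodA.exists_smul_invClass_eq ha (b := b) hb
    change f (c • invClass K v a) = 0
    rw [map_smul, hf, smul_zero]
  refine ⟨ofLinearMap (g.ker.liftQ f₀ hker ∘ₗ (g.quotKerEquivOfSurjective hg).symm.toLinearMap),
    DFunLike.ext _ _ fun b => ?_⟩
  rw [smul_apply, KmodA.algebraMap_smul_eq, ofLinearMap_apply, LinearMap.comp_apply]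
  have : (g.quotKerEquivOfSurjective hg).symm (a • b) = g.ker.mkQ b := by
    rw [LinearEquiv.symm_apply_eq]
    rfl
  rw [LinearEquiv.coe_coe, this]
  rfl

end HomKmodA

end Hom

/-! ### Compatible pairings on torsion -/

/-- For `A`-modules `P` and `Q` and a prime `p`: pairings `P[a] × Q[a] → F_q`, one for each `a`,
biadditive, `F_q`-linear, compatible with multiplication in `A`, and perfect for `a ∉ p`; both
modules are injective. Only the values of `pair a` on `P[a] × Q[a]` matter. The data are symmetric
in `P` and `Q`. -/
structure CompatiblePairing (Fq : Type*) [Field Fq] {A : Type*} [CommRing A] [Algebra Fq A]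
    (p : Ideal A) (P Q : Type*) [AddCommGroup P] [Module A P] [AddCommGroup Q] [Module A Q] where
  pair : A → P → Q → Fq
  add_left : ∀ a x x' y, a • x = 0 → a • x' = 0 → a • y = 0 →
    pair a (x + x') y = pair a x y + pair a x' y
  add_right : ∀ a x y y', a • x = 0 → a • y = 0 → a • y' = 0 →
    pair a x (y + y') = pair a x y + pair a x y'
  algebraMap_smul : ∀ a (c : Fq) x y, a • x = 0 → a • y = 0 →
    pair a (algebraMap Fq A c • x) y = c * pair a x y
  mul_left : ∀ a c x y, a • x = 0 → (a * c) • y = 0 → pair (a * c) x y = pair a x (c • y)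
  mul_right : ∀ a c x y, (a * c) • x = 0 → a • y = 0 → pair (a * c) x y = pair a (c • x) y
  nondeg_left : ∀ a ∉ p, ∀ x, a • x = 0 → (∀ y, a • y = 0 → pair a x y = 0) → x = 0
  nondeg_right : ∀ a ∉ p, ∀ y, a • y = 0 → (∀ x, a • x = 0 → pair a x y = 0) → y = 0
  finite_left : ∀ a ∉ p, {x : P | a • x = 0}.Finite
  finite_right : ∀ a ∉ p, {y : Q | a • y = 0}.Finite
  baer_left : Module.Baer A P
  baer_right : Module.Baer A Q

section CompatiblePairing

attribute [local instance] KmodA.moduleFq KmodA.smulCommClassFq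

namespace CompatiblePairing

variable {Fq : Type*} [Field Fq] {A : Type*} [CommRing A] [Algebra Fq A]
  {p : Ideal A} {P Q : Type*} [AddCommGroup P] [Module A P] [AddCommGroup Q] [Module A Q]
  (D : CompatiblePairing Fq p P Q)

theorem smul_smul_eq_zero {a : A} (c : A) {x : P} (hx : a • x = 0) : a • c • x = 0 := by
  rw [smul_comm, hx, smul_zero]

theorem mul_smul_eq_zero {a : A} (c : A) {x : P} (hx : a • x = 0) : (a * c) • x = 0 := by
  rw [mul_smul, smul_smul_eq_zero c hx]

theorem pair_smul_comm {a : A} (c : A) {x : P} {y : Q} (hx : a • x = 0) (hy : a • y = 0) :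
    D.pair a (c • x) y = D.pair a x (c • y) := by
  rw [← D.mul_right a c x y (mul_smul_eq_zero c hx) hy,
    D.mul_left a c x y hx (mul_smul_eq_zero c hy)]

/-- The same pairings with the roles of the two modules exchanged. -/
def flip : CompatiblePairing Fq p Q P where
  pair a y x := D.pair a x y
  add_left a y y' x hy hy' hx := D.add_right a x y y' hx hy hy'
  add_right a y x x' hy hx hx' := D.add_left a x x' y hx hx' hy
  algebraMap_smul a c y x hy hx := by
    rw [← D.pair_smul_comm _ hx hy, D.algebraMap_smul a c x y hx hy]
  mul_left a c y x hy hx := D.mul_right a c x y hx hy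
  mul_right a c y x hy hx := D.mul_left a c x y hx hy
  nondeg_left := D.nondeg_right
  nondeg_right := D.nondeg_left
  finite_left := D.finite_right
  finite_right := D.finite_left
  baer_left := D.baer_right
  baer_right := D.baer_left

/-- Perfectness of the pairing on `P[a] × Q[a]`: an `F_q`-linear functional on a space `V` that
factors through a map `V → Q[a]` is the pairing with an element of `P[a]`. -/
theorem exists_pair_eq {a : A} (ha : a ∉ p) {V : Type*} [AddCommGroup V] [Module Fq V]
    (ev : V →+ Q) (hsmul : ∀ (c : Fq) w, ev (c • w) = algebraMap Fq A c • ev w)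
    (hev : ∀ w, a • ev w = 0) (f : V →ₗ[Fq] Fq) (hf : ∀ w, ev w = 0 → f w = 0) :
    ∃ x, a • x = 0 ∧ ∀ w, D.pair a x (ev w) = f w := by
  let _ : Module Fq P := Module.compHom P (algebraMap Fq A)
  let _ : Module Fq Q := Module.compHom Q (algebraMap Fq A)
  let TP : Submodule Fq P :=
    { carrier := {x | a • x = 0}
      add_mem' := fun {x y} hx hy => by
        rw [Set.mem_ofPred_eq] at *
        rw [smul_add, hx, hy, add_zero]
      zero_mem' := smul_zero a
      smul_mem' := fun c x hx => smul_smul_eq_zero (algebraMap Fq A c) hx }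
  let TQ : Submodule Fq Q :=
    { carrier := {x | a • x = 0}
      add_mem' := fun {x y} hx hy => by
        rw [Set.mem_ofPred_eq] at *
        rw [smul_add, hx, hy, add_zero]
      zero_mem' := smul_zero a
      smul_mem' := fun c x hx => smul_smul_eq_zero (algebraMap Fq A c) hx }
  let B : TP →ₗ[Fq] TQ →ₗ[Fq] Fq := LinearMap.mk₂ Fq (fun x y => D.pair a x y)
    (fun x x' y => D.add_left a x x' y x.2 x'.2 y.2)
    (fun c x y => D.algebraMap_smul a c x y x.2 y.2)
    (fun x y y' => D.add_right a x y y' x.2 y.2 y'.2)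
    (fun c x y => D.flip.algebraMap_smul a c y x y.2 x.2)
  have : Finite TP := (D.finite_left a ha).to_subtype
  have : B.IsPerfPair := by
    apply LinearMap.IsPerfPair.of_injective
    · rw [injective_iff_map_eq_zero]
      intro x hx
      exact Subtype.ext (D.nondeg_left a ha x x.2 fun y hy =>
        LinearMap.congr_fun hx (⟨y, hy⟩ : TQ))
    · rw [injective_iff_map_eq_zero]
      intro y hy
      exact Subtype.ext (D.nondeg_right a ha y y.2 fun x hx =>
        LinearMap.congr_fun hy (⟨x, hx⟩ : TP))
  let ev' : V →ₗ[Fq] TQ :=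
    { toFun := fun w => ⟨ev w, hev w⟩
      map_add' := fun w w' => Subtype.ext (map_add ev w w')
      map_smul' := fun c w => Subtype.ext (hsmul c w) }
  have hf' : f ∈ LinearMap.range ev'.dualMap := by
    rw [LinearMap.range_dualMap_eq_dualAnnihilator_ker, Submodule.mem_dualAnnihilator]
    exact fun w hw => hf w (congrArg Subtype.val hw)
  obtain ⟨g, rfl⟩ := hf'
  obtain ⟨x, hx⟩ := (LinearMap.IsPerfPair.bijective_left B).2 g
  exact ⟨x, x.2, fun w => LinearMap.congr_fun hx (ev' w)⟩

variable [IsDedekindDomain A] {K : Type*} [Field K] [Algebra A K] [IsFractionRing A K]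
  {v : HeightOneSpectrum A}

open Classical in
/-- The pairing of a torsion element `x ∈ P` with `β : K_𝔮/A_𝔮 → Q`: the common value of
`⟨x, β(a⁻¹)⟩_a` for all nonzero `a` with `a x = 0`. -/
def eval (x : P) (β : HomKmodA K v A Q) : Fq :=
  if h : ∃ a : A, a ≠ 0 ∧ a • x = 0 then D.pair h.choose x (β (invClass K v h.choose)) else 0

theorem smul_apply_invClass (β : HomKmodA K v A Q) (a : A) : a • β (invClass K v a) = 0 := by
  rw [← map_smul, KmodA.smul_invClass_self, map_zero]

theorem pair_mul_invClass (x : P) (β : HomKmodA K v A Q) {a c : A} (hc : c ≠ 0)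
    (hx : a • x = 0) :
    D.pair (a * c) x (β (invClass K v (a * c))) = D.pair a x (β (invClass K v a)) := by
  rw [D.mul_left a c x _ hx (smul_apply_invClass β _), ← map_smul, KmodA.smul_invClass_mul a hc]

theorem eval_eq {x : P} (β : HomKmodA K v A Q) {a : A} (ha : a ≠ 0) (hx : a • x = 0) :
    D.eval x β = D.pair a x (β (invClass K v a)) := by
  have h : ∃ a : A, a ≠ 0 ∧ a • x = 0 := ⟨a, ha, hx⟩
  rw [eval, dif_pos h, ← D.pair_mul_invClass x β ha h.choose_spec.2, mul_comm,
    D.pair_mul_invClass x β h.choose_spec.1 hx]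

theorem eval_add_left {x x' : P} (β : HomKmodA K v A Q) (hx : ∃ a : A, a ≠ 0 ∧ a • x = 0)
    (hx' : ∃ a : A, a ≠ 0 ∧ a • x' = 0) : D.eval (x + x') β = D.eval x β + D.eval x' β := by
  obtain ⟨a, ha, hax⟩ := hx
  obtain ⟨a', ha', hax'⟩ := hx'
  have h := mul_ne_zero ha ha'
  have h1 : (a * a') • x = 0 := mul_smul_eq_zero a' hax
  have h2 : (a * a') • x' = 0 := by rw [mul_comm]; exact mul_smul_eq_zero a hax'
  rw [D.eval_eq β h h1, D.eval_eq β h h2, D.eval_eq β h (by rw [smul_add, h1, h2, add_zero]),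
    D.add_left _ _ _ _ h1 h2 (smul_apply_invClass β _)]

theorem eval_add_right {x : P} (β β' : HomKmodA K v A Q) (hx : ∃ a : A, a ≠ 0 ∧ a • x = 0) :
    D.eval x (β + β') = D.eval x β + D.eval x β' := by
  obtain ⟨a, ha, hax⟩ := hx
  rw [D.eval_eq β ha hax, D.eval_eq β' ha hax, D.eval_eq _ ha hax, HomKmodA.add_apply,
    D.add_right _ _ _ _ hax (smul_apply_invClass β _) (smul_apply_invClass β' _)]

theorem eval_smul_comm {x : P} (c : A) (β : HomKmodA K v A Q) (hx : ∃ a : A, a ≠ 0 ∧ a • x = 0) :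
    D.eval (c • x) β = D.eval x (algebraMap A (v.adicCompletionIntegers K) c • β) := by
  obtain ⟨a, ha, hax⟩ := hx
  rw [D.eval_eq _ ha hax, D.eval_eq _ ha (smul_smul_eq_zero c hax),
    HomKmodA.algebraMap_smul_apply, D.pair_smul_comm c hax (smul_apply_invClass β _)]

theorem eval_algebraMap_smul {x : P} (c : Fq) (β : HomKmodA K v A Q)
    (hx : ∃ a : A, a ≠ 0 ∧ a • x = 0) :
    D.eval (algebraMap Fq A c • x) β = c * D.eval x β := by
  obtain ⟨a, ha, hax⟩ := hx
  rw [D.eval_eq _ ha hax, D.eval_eq _ ha (smul_smul_eq_zero _ hax),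
    D.algebraMap_smul _ _ _ _ hax (smul_apply_invClass β _)]

theorem exists_ne_zero_smul_eq_zero_of_pow {x : P} {n : ℕ} (h : ∀ d ∈ v.asIdeal ^ n, d • x = 0) :
    ∃ a : A, a ≠ 0 ∧ a • x = 0 := by
  obtain ⟨a, ha, ha0⟩ := Submodule.exists_mem_ne_zero_of_ne_bot (pow_ne_zero n v.ne_bot)
  exact ⟨a, ha0, h a ha⟩

theorem exists_ne_zero_smul_eq_zero (b : KmodA K v) : ∃ a : A, a ≠ 0 ∧ a • b = 0 := by
  obtain ⟨n, hn⟩ := KmodA.exists_pow_smul_eq_zero b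
  exact exists_ne_zero_smul_eq_zero_of_pow hn

theorem exists_ne_zero_smul_apply_eq_zero (α : HomKmodA K v A P) (b : KmodA K v) :
    ∃ a : A, a ≠ 0 ∧ a • α b = 0 := by
  obtain ⟨a, ha, h⟩ := exists_ne_zero_smul_eq_zero b
  exact ⟨a, ha, by rw [← map_smul, h, map_zero]⟩

/-- An element of `A_𝔮` can be moved from one side to the other, because on any given torsion
element of `K_𝔮/A_𝔮` it acts as an element of `A`. -/
theorem eval_apply_smul_comm (α : HomKmodA K v A P) (β : HomKmodA K v A Q)
    (s : v.adicCompletionIntegers K) (b : KmodA K v) :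
    D.eval (α b) (s • β) = D.eval (α (s • b)) β := by
  obtain ⟨n, hn⟩ := KmodA.exists_pow_smul_eq_zero b
  obtain ⟨a, ha0, hab⟩ := exists_ne_zero_smul_eq_zero b
  obtain ⟨m, hm⟩ := KmodA.exists_pow_smul_eq_zero (invClass K v a)
  obtain ⟨c, hc⟩ := KmodA.exists_smul_eq_smul s (max n m)
  have h1 := hc b fun d hd => hn d (Ideal.pow_le_pow_right (le_max_left n m) hd)
  have h2 := hc (invClass K v a) fun d hd => hm d (Ideal.pow_le_pow_right (le_max_right n m) hd)
  have hx : a • α b = 0 := by rw [← map_smul, hab, map_zero]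
  rw [D.eval_eq _ ha0 hx, HomKmodA.smul_apply, h1, h2, map_smul, map_smul,
    D.eval_eq _ ha0 (smul_smul_eq_zero c hx), D.pair_smul_comm c hx (smul_apply_invClass β a)]

/-- The limit pairing `[α, β](b) = ⟨α(b), β(a⁻¹)⟩_a`, for any nonzero `a` with `a b = 0`. -/
def limit : HomKmodA K v A P →ₗ[v.adicCompletionIntegers K]
    HomKmodA K v A Q →ₗ[v.adicCompletionIntegers K] FqDual K v Fq :=
  LinearMap.mk₂ _
    (fun α β => HomKmodA.ofLinearMap
      { toFun := fun b => D.eval (α b) β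
        map_add' := fun b b' => by
          rw [map_add, D.eval_add_left β (exists_ne_zero_smul_apply_eq_zero α b)
            (exists_ne_zero_smul_apply_eq_zero α b')]
        map_smul' := fun c b => by
          change D.eval (α (algebraMap Fq A c • b)) β = c * D.eval (α b) β
          rw [map_smul, D.eval_algebraMap_smul c β (exists_ne_zero_smul_apply_eq_zero α b)] })
    (fun α α' β => DFunLike.ext _ _ fun b => D.eval_add_left β
      (exists_ne_zero_smul_apply_eq_zero α b) (exists_ne_zero_smul_apply_eq_zero α' b))
    (fun _ _ _ => rfl)
    (fun α β β' => DFunLike.ext _ _ fun b => D.eval_add_right β β'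
      (exists_ne_zero_smul_apply_eq_zero α b))
    (fun s α β => DFunLike.ext _ _ fun b => D.eval_apply_smul_comm α β s b)

theorem limit_apply (α : HomKmodA K v A P) (β : HomKmodA K v A Q) (b : KmodA K v) :
    D.limit α β b = D.eval (α b) β := rfl

theorem limit_apply_eq_pair (α : HomKmodA K v A P) (β : HomKmodA K v A Q) {b : KmodA K v} {a : A}
    (ha : a ≠ 0) (hab : a • b = 0) :
    D.limit α β b = D.pair a (α b) (β (invClass K v a)) :=
  D.eval_eq β ha (by rw [← map_smul, hab, map_zero])

/-- The limit pairing is symmetric in its two arguments: if `b = c a⁻¹`, then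
`⟨c α(a⁻¹), β(a⁻¹)⟩_a = ⟨α(a⁻¹), c β(a⁻¹)⟩_a`. -/
theorem flip_limit : (D.limit (K := K) (v := v)).flip = D.flip.limit := by
  refine LinearMap.ext₂ fun β α => DFunLike.ext _ _ fun b => ?_
  obtain ⟨a, ha, hab⟩ := exists_ne_zero_smul_eq_zero b
  rw [LinearMap.flip_apply, D.limit_apply_eq_pair α β ha hab,
    D.flip.limit_apply_eq_pair β α ha hab]
  obtain ⟨c, rfl⟩ := KmodA.exists_smul_invClass_eq ha hab
  rw [map_smul, map_smul]
  exact D.pair_smul_comm c (smul_apply_invClass α a) (smul_apply_invClass β a)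

/-- The projector onto the `𝔮`-primary part of the `a`-torsion, for `a` of exact valuation `n`. -/
theorem exists_projector {a : A} {n : ℕ} (ha : a ∈ v.asIdeal ^ n) (ha' : a ∉ v.asIdeal ^ (n + 1)) :
    ∃ e : A, 1 - e ∈ v.asIdeal ^ n ∧ ∀ d ∈ v.asIdeal ^ n, a ∣ d * e := by
  obtain ⟨J, hJ⟩ := Ideal.dvd_span_singleton.mpr ha
  have hJv : ¬ J ≤ v.asIdeal := by
    intro h
    apply ha'
    rw [← Ideal.span_singleton_le_iff_mem, hJ, pow_succ]
    exact Ideal.mul_mono_right h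
  have hcop : v.asIdeal ^ n ⊔ J = ⊤ := by
    refine Ideal.pow_sup_eq_top ?_
    exact v.isMaximal.1.2 _ (left_lt_sup.mpr hJv)
  obtain ⟨y, hy, e, he, hye⟩ := Submodule.mem_sup.mp (hcop ▸ Submodule.mem_top : (1 : A) ∈ _)
  refine ⟨e, by rwa [← hye, add_sub_cancel_right], fun d hd => ?_⟩
  rw [← Ideal.mem_span_singleton, hJ]
  exact Ideal.mul_mem_mul hd he

/-- The elements `β(a⁻¹)` separate the elements of `P` killed by `𝔮 ^ n`. -/
theorem eq_zero_of_eval_eq_zero [p.IsPrime] (hv : v.asIdeal ≠ p) {x : P} {n : ℕ}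
    (hx : ∀ d ∈ v.asIdeal ^ n, d • x = 0) (h : ∀ β : HomKmodA K v A Q, D.eval x β = 0) :
    x = 0 := by
  obtain ⟨a, ha, ha', hap⟩ := exists_mem_pow_not_mem_pow_succ_not_mem v p hv n
  have ha0 : a ≠ 0 := by
    rintro rfl
    exact hap (zero_mem p)
  obtain ⟨e, he, hde⟩ := exists_projector ha ha'
  refine D.nondeg_left a hap x (hx a ha) fun y hy => ?_
  obtain ⟨β, hβ⟩ := HomKmodA.exists_apply_eq (K := K) (v := v) D.baer_right
    (b := invClass K v a) (y := e • y) fun c hc => by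
      rw [KmodA.smul_invClass_eq_zero_iff_mem_pow ha ha'] at hc
      obtain ⟨r, hr⟩ := hde c hc
      rw [smul_smul, hr, mul_smul_eq_zero r hy]
  have hex : e • x = x := by
    have := hx _ he
    rwa [sub_smul, one_smul, sub_eq_zero, eq_comm] at this
  have := h β
  rwa [D.eval_eq β ha0 (hx a ha), hβ, ← D.pair_smul_comm e (hx a ha) hy, hex] at this

/-- Every value of an `A_𝔮`-linear map from `Hom(K_𝔮/A_𝔮, Q)` to the dual of `K_𝔮/A_𝔮` at a given
`b ∈ K_𝔮/A_𝔮` is the pairing with an element of `P`: it factors through evaluation at `a⁻¹` for a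
suitable `a`. -/
theorem exists_eval_eq [p.IsPrime] (hv : v.asIdeal ≠ p)
    (F : HomKmodA K v A Q →ₗ[v.adicCompletionIntegers K] FqDual K v Fq) (b : KmodA K v) :
    ∃ x : P, (∃ n : ℕ, ∀ d ∈ v.asIdeal ^ n, d • x = 0) ∧ ∀ β, D.eval x β = F β b := by
  obtain ⟨n, hn⟩ := KmodA.exists_pow_smul_eq_zero b
  obtain ⟨a, ha, ha', hap⟩ := exists_mem_pow_not_mem_pow_succ_not_mem v p hv n
  have ha0 : a ≠ 0 := by
    rintro rfl
    exact hap (zero_mem p)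
  obtain ⟨e, he, hde⟩ := exists_projector ha ha'
  let _ : Module Fq (HomKmodA K v A Q) :=
    Module.compHom _ ((algebraMap A (v.adicCompletionIntegers K)).comp (algebraMap Fq A))
  have hsmul : ∀ (c : Fq) (β : HomKmodA K v A Q),
      c • β = algebraMap A (v.adicCompletionIntegers K) (algebraMap Fq A c) • β :=
    fun _ _ => rfl
  let ev : HomKmodA K v A Q →+ Q :=
    { toFun := fun β => β (invClass K v a)
      map_zero' := rfl
      map_add' := fun _ _ => rfl }
  let f : HomKmodA K v A Q →ₗ[Fq] Fq :=
    { toFun := fun β => F β b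
      map_add' := fun β β' => by rw [map_add, HomKmodA.add_apply]
      map_smul' := fun c β => by
        rw [hsmul, map_smul, HomKmodA.smul_apply, KmodA.algebraMap_smul_eq]
        exact map_smul (F β) c b }
  obtain ⟨x, hx, hxβ⟩ := D.exists_pair_eq hap ev
    (fun c β => HomKmodA.algebraMap_smul_apply (algebraMap Fq A c) β _)
    (fun β => smul_apply_invClass β a) f (by
      intro β hβ
      obtain ⟨β', rfl⟩ := HomKmodA.exists_smul_eq_of_apply_invClass ha0 hβ
      change F _ b = 0
      rw [map_smul, HomKmodA.smul_apply, KmodA.algebraMap_smul_eq, hn a ha, map_zero])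
  have hex : a • e • x = 0 := smul_smul_eq_zero e hx
  refine ⟨e • x, ⟨n, fun d hd => ?_⟩, fun β => ?_⟩
  · obtain ⟨r, hr⟩ := hde d hd
    rw [smul_smul, hr, mul_smul_eq_zero r hx]
  · have hey : e • β (invClass K v a) = β (invClass K v a) := by
      have h1 : (1 - e) • invClass K v a = 0 :=
        (KmodA.smul_invClass_eq_zero_iff_mem_pow ha ha' _).mpr he
      have h2 : (1 - e) • β (invClass K v a) = 0 := by rw [← map_smul, h1, map_zero]
      rwa [sub_smul, one_smul, sub_eq_zero, eq_comm] at h2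
    rw [D.eval_eq β ha0 hex, D.pair_smul_comm e hx (smul_apply_invClass β a), hey]
    exact hxβ β

/-- Half of the perfectness of the limit pairing: `α(b)` is recovered from `F` as the unique
`𝔮`-primary element `x` of `P` with `⟨x, β(a⁻¹)⟩_a = F(β)(b)` for all `β`. -/
theorem limit_bijective [p.IsPrime] (hv : v.asIdeal ≠ p) :
    Function.Bijective (D.limit (K := K) (v := v)) := by
  -- uniqueness among the `𝔮`-primary elements
  have uniq : ∀ x x' : P, (∃ n : ℕ, ∀ d ∈ v.asIdeal ^ n, d • x = 0) →
      (∃ n : ℕ, ∀ d ∈ v.asIdeal ^ n, d • x' = 0) →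
      (∀ β : HomKmodA K v A Q, D.eval x β = D.eval x' β) → x = x' := by
    rintro x x' ⟨n, hn⟩ ⟨n', hn'⟩ h
    have hs : ∀ d ∈ v.asIdeal ^ max n n', d • (x - x') = 0 := fun d hd => by
      rw [smul_sub, hn d (Ideal.pow_le_pow_right (le_max_left _ _) hd),
        hn' d (Ideal.pow_le_pow_right (le_max_right _ _) hd), sub_zero]
    rw [← sub_eq_zero]
    refine D.eq_zero_of_eval_eq_zero (K := K) hv hs fun β => ?_
    have := D.eval_add_left β (exists_ne_zero_smul_eq_zero_of_pow hs)
      (exists_ne_zero_smul_eq_zero_of_pow hn')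
    rwa [sub_add_cancel, h, right_eq_add] at this
  have prim : ∀ (α : HomKmodA K v A P) (b : KmodA K v),
      ∃ n : ℕ, ∀ d ∈ v.asIdeal ^ n, d • α b = 0 := by
    intro α b
    obtain ⟨n, hn⟩ := KmodA.exists_pow_smul_eq_zero b
    exact ⟨n, fun d hd => by rw [← map_smul, hn d hd, map_zero]⟩
  constructor
  · intro α α' h
    refine DFunLike.ext _ _ fun b => uniq _ _ (prim α b) (prim α' b) fun β => ?_
    rw [← D.limit_apply, ← D.limit_apply, h]
  · intro F
    choose α hα hαF using D.exists_eval_eq hv F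
    refine ⟨HomKmodA.ofLinearMap ⟨⟨α, fun b b' => ?_⟩, fun c b => ?_⟩, ?_⟩
    · obtain ⟨n, hn⟩ := hα b
      obtain ⟨n', hn'⟩ := hα b'
      refine uniq _ _ (hα _) ⟨max n n', fun d hd => ?_⟩ fun β => ?_
      · rw [smul_add, hn d (Ideal.pow_le_pow_right (le_max_left _ _) hd),
          hn' d (Ideal.pow_le_pow_right (le_max_right _ _) hd), add_zero]
      · rw [D.eval_add_left β (exists_ne_zero_smul_eq_zero_of_pow hn)
          (exists_ne_zero_smul_eq_zero_of_pow hn'), hαF, hαF, hαF, map_add]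
    · obtain ⟨n, hn⟩ := hα b
      refine uniq _ _ (hα _) ⟨n, fun d hd => smul_smul_eq_zero c (hn d hd)⟩ fun β => ?_
      change _ = D.eval (c • α b) β
      rw [D.eval_smul_comm c β (exists_ne_zero_smul_eq_zero_of_pow hn), hαF, hαF, map_smul F,
        HomKmodA.smul_apply, KmodA.algebraMap_smul_eq]
    · exact LinearMap.ext fun β => DFunLike.ext _ _ fun b => hαF b β

theorem limit_flip_bijective [p.IsPrime] (hv : v.asIdeal ≠ p) :
    Function.Bijective (D.limit (K := K) (v := v)).flip := by
  rw [flip_limit]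
  exact D.flip.limit_bijective hv

/-- The value of the pairing at `b` depends on `α(b)` and `β(a⁻¹)` only, where `a b = 0`. -/
theorem continuous_limit :
    Continuous (fun q : HomKmodA K v A P × HomKmodA K v A Q => D.limit q.1 q.2) := by
  refine HomKmodA.continuous_of_locally_const fun b q => ?_
  obtain ⟨a, ha, hab⟩ := exists_ne_zero_smul_eq_zero b
  refine ⟨_, (HomKmodA.isOpen_setOf_apply_eq b (q.1 b)).prod
    (HomKmodA.isOpen_setOf_apply_eq (invClass K v a) (q.2 (invClass K v a))), ⟨rfl, rfl⟩, ?_⟩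
  rintro q' ⟨h1, h2⟩
  rw [D.limit_apply_eq_pair _ _ ha hab, D.limit_apply_eq_pair _ _ ha hab, h1, h2]

end CompatiblePairing

end CompatiblePairing

/-! ### The `F_q`-valued pairing of a separable linear polynomial -/

section Linear

variable {Fq : Type*} [Field Fq] [Fintype Fq] {F : Type*} [Field F] [Algebra Fq F] [IsAlgClosed F]

variable (Fq) in
open Classical in
/-- The pairing `⟨α, β⟩_f` as an element of `F_q`, for `α ∈ ker f` and `β ∈ ker f*`. -/
def pairingFq (f : F[X]) (α β : F) : Fq :=
  if h : ∃ c : Fq, algebraMap Fq F c = pairing Fq f α β then h.choose else 0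

theorem algebraMap_pairingFq {f : F[X]} (hf : IsLinear Fq f) {α β : F}
    (hα : f.eval α = 0) (hβ : adjoint Fq f β = 0) :
    algebraMap Fq F (pairingFq Fq f α β) = pairing Fq f α β := by
  have h := exists_algebraMap_eq_pairing hf hα hβ
  rw [pairingFq, dif_pos h]
  exact h.choose_spec

theorem adjoint_smul (f : F[X]) (c : Fq) (x : F) : adjoint Fq f (c • x) = c • adjoint Fq f x := by
  rw [Algebra.smul_def, Algebra.smul_def, adjoint_algebraMap_mul]

theorem IsLinear.eval_smul {f : F[X]} (hf : IsLinear Fq f) (c : Fq) (x : F) :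
    f.eval (c • x) = c • f.eval x := by
  have := congrArg (eval 1) (hf.comp_algebraMap_mul c (C x))
  simpa [Algebra.smul_def] using this

theorem pairing_smul_left {f : F[X]} (hf : IsLinear Fq f) {α : F} (hα : f.eval α = 0)
    (c : Fq) (β : F) : pairing Fq f (c • α) β = c • pairing Fq f α β := by
  rw [Algebra.smul_def, Algebra.smul_def, pairing_algebraMap_mul_left hf hα]

theorem pairing_smul_right (f : F[X]) (α : F) (c : Fq) (β : F) :
    pairing Fq f α (c • β) = c • pairing Fq f α β := adjoint_smul _ _ _

/-- Right nondegeneracy: `ker f` and `ker f*` have the same dimension, so it follows from left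
nondegeneracy. -/
theorem eq_zero_of_pairing_eq_zero_right {f : F[X]} (hf : IsLinear Fq f) (h1 : f.coeff 1 ≠ 0)
    {β : F} (hβ : adjoint Fq f β = 0) (h : ∀ α, f.eval α = 0 → pairing Fq f α β = 0) : β = 0 := by
  let V : Submodule Fq F :=
    { carrier := {x | f.eval x = 0}
      add_mem' := fun {x y} hx hy => by
        rw [Set.mem_ofPred_eq] at *
        rw [hf.eval_add, hx, hy, add_zero]
      zero_mem' := hf.eval_zero
      smul_mem' := fun c x hx => by
        rw [Set.mem_ofPred_eq] at *
        rw [hf.eval_smul, hx, smul_zero] }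
  let W : Submodule Fq F :=
    { carrier := {x | adjoint Fq f x = 0}
      add_mem' := fun {x y} hx hy => by
        rw [Set.mem_ofPred_eq] at *
        rw [adjoint_add_right, hx, hy, add_zero]
      zero_mem' := adjoint_zero_right f
      smul_mem' := fun c x hx => by
        rw [Set.mem_ofPred_eq] at *
        rw [adjoint_smul, hx, smul_zero] }
  have inj := (algebraMap Fq F).injective
  let B : V →ₗ[Fq] W →ₗ[Fq] Fq := LinearMap.mk₂ Fq (fun x y => pairingFq Fq f x y)
    (fun x x' y => inj (by
      rw [map_add, algebraMap_pairingFq hf (x + x').2 y.2, algebraMap_pairingFq hf x.2 y.2,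
        algebraMap_pairingFq hf x'.2 y.2]
      exact pairing_add_left hf x.2 x'.2 y))
    (fun c x y => inj (by
      rw [smul_eq_mul, map_mul, algebraMap_pairingFq hf (c • x).2 y.2,
        algebraMap_pairingFq hf x.2 y.2, ← Algebra.smul_def]
      exact pairing_smul_left hf x.2 c y))
    (fun x y y' => inj (by
      rw [map_add, algebraMap_pairingFq hf x.2 (y + y').2, algebraMap_pairingFq hf x.2 y.2,
        algebraMap_pairingFq hf x.2 y'.2]
      exact pairing_add_right f x y y'))
    (fun c x y => inj (by
      rw [smul_eq_mul, map_mul, algebraMap_pairingFq hf x.2 (c • y).2,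
        algebraMap_pairingFq hf x.2 y.2, ← Algebra.smul_def]
      exact pairing_smul_right f x c y))
  have hB : ∀ (x : V) (y : W), algebraMap Fq F (B x y) = pairing Fq f x y :=
    fun x y => algebraMap_pairingFq hf x.2 y.2
  have hVc : Nat.card V = f.natDegree := hf.ncard_eval_eq_zero h1
  have hWc : Nat.card W = f.natDegree := hf.ncard_adjoint_eq_zero h1
  have hd : 0 < f.natDegree := by
    obtain ⟨d, hd⟩ := hf.exists_natDegree_eq (fun h0 => h1 (by rw [h0, coeff_zero]))
    rw [hd]
    exact pow_pos Fintype.card_pos d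
  have : Finite V := Nat.finite_of_card_ne_zero (hVc ▸ hd.ne')
  have : Finite W := Nat.finite_of_card_ne_zero (hWc ▸ hd.ne')
  have hfin : Module.finrank Fq V = Module.finrank Fq (Module.Dual Fq W) := by
    rw [Subspace.dual_finrank_eq]
    apply Nat.pow_right_injective (Finite.one_lt_card (α := Fq))
    change Nat.card Fq ^ _ = Nat.card Fq ^ _
    rw [← Module.natCard_eq_pow_finrank, ← Module.natCard_eq_pow_finrank, hVc, hWc]
  have hinj : Function.Injective B := by
    rw [injective_iff_map_eq_zero]
    intro x hx
    refine Subtype.ext (eq_zero_of_pairing_eq_zero hf h1 x.2 fun y hy => ?_)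
    rw [← hB x ⟨y, hy⟩, hx, LinearMap.zero_apply, map_zero]
  have hsurj := (LinearMap.injective_iff_surjective_of_finrank_eq_finrank hfin).mp hinj
  have hz : (⟨β, hβ⟩ : W) = 0 := by
    rw [← Module.forall_dual_apply_eq_zero_iff Fq]
    intro g
    obtain ⟨x, rfl⟩ := hsurj g
    apply inj
    rw [hB, map_zero]
    exact h x x.2
  exact congrArg Subtype.val hz

end Linear

/-! ### The torsion pairings of a Drinfeld module -/

namespace DrinfeldModule

variable {Fq : Type*} [Field Fq] [Fintype Fq] {A L : Type*} [CommRing A] [Field L]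
  [Algebra Fq A] [Algebra Fq L] {ι : A →ₐ[Fq] L} (φ : DrinfeldModule Fq ι)

theorem toPoly_zero : φ.toPoly 0 = 0 := by
  have := φ.map_add 0 0
  rwa [add_zero, left_eq_add] at this

theorem toPoly_eq_of_comp_eq_X {a : A} {g : L[X]} (h : g.comp (φ.toPoly a) = X) :
    φ.toPoly a = C (ι a) * X := by
  have hd := congrArg natDegree h
  rw [natDegree_comp, natDegree_X] at hd
  have := eq_X_add_C_of_natDegree_le_one (Nat.eq_one_of_mul_eq_one_left hd).le
  rwa [φ.coeff_one, coeff_zero_eq_eval_zero, (φ.isLinear a).eval_zero, C_0, add_zero] at this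

/-- Constants act through `ι`, because they are zero or units and the only invertible elements of
`L{τ}` are constants. -/
theorem toPoly_algebraMap (c : Fq) :
    φ.toPoly (algebraMap Fq A c) = C (algebraMap Fq L c) * X := by
  rcases eq_or_ne c 0 with rfl | hc
  · rw [_root_.map_zero, _root_.map_zero, C_0, zero_mul, toPoly_zero]
  · have h : (φ.toPoly (algebraMap Fq A c⁻¹)).comp (φ.toPoly (algebraMap Fq A c)) = X := by
      rw [← φ.map_mul, ← _root_.map_mul, inv_mul_cancel₀ hc, _root_.map_one, φ.map_one]
    rw [φ.toPoly_eq_of_comp_eq_X h, AlgHom.commutes]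

theorem polyBar_algebraMap (c : Fq) :
    φ.polyBar (algebraMap Fq A c) = C (algebraMap Fq (AlgebraicClosure L) c) * X := by
  rw [polyBar, toPoly_algebraMap, Polynomial.map_mul, map_C, map_X,
    ← IsScalarTower.algebraMap_apply]

/-- The kernel of `a ↦ φ_a` is a prime ideal. If it were nonzero it would be maximal, so that every
`φ_a` would be zero or invertible in `L{τ}`, hence equal to `ι a`. -/
theorem toPoly_ne_zero [IsDedekindDomain A] {a : A} (ha : a ≠ 0) : φ.toPoly a ≠ 0 := by
  intro h0
  let I : Ideal A :=
    { carrier := {a | φ.toPoly a = 0}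
      add_mem' := fun {x y} hx hy => by
        rw [Set.mem_ofPred_eq] at *
        rw [φ.map_add, hx, hy, add_zero]
      zero_mem' := φ.toPoly_zero
      smul_mem' := fun c x hx => by
        rw [Set.mem_ofPred_eq] at *
        rw [smul_eq_mul, φ.map_mul, hx, comp_zero, (φ.isLinear c).eval_zero, C_0] }
  have hI : ∀ x, x ∈ I ↔ φ.toPoly x = 0 := fun _ => Iff.rfl
  have hprime : I.IsPrime := by
    refine ⟨fun h => ?_, fun {x y} hxy => ?_⟩
    · have := (hI 1).mp (h ▸ Submodule.mem_top)
      rw [φ.map_one] at this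
      exact X_ne_zero this
    · rw [hI, φ.map_mul, comp_eq_zero_iff] at hxy
      refine hxy.imp id fun hy => ?_
      rw [hI, hy.2, coeff_zero_eq_eval_zero, (φ.isLinear y).eval_zero, C_0]
  have hmax : I.IsMaximal := hprime.isMaximal fun h => ha (by
    have : a ∈ I := h0
    rwa [h, Ideal.mem_bot] at this)
  obtain ⟨b, hb⟩ := φ.nontrivial
  apply hb
  by_cases hbI : b ∈ I
  · have : φ.toPoly b = 0 := hbI
    rw [← φ.coeff_one b, this, coeff_zero, C_0, zero_mul]
  · obtain ⟨y, i, hi, hyi⟩ := hmax.exists_inv hbI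
    refine φ.toPoly_eq_of_comp_eq_X (g := φ.toPoly y) ?_
    rw [← φ.map_mul, ← φ.map_one, ← hyi, φ.map_add, (hI i).mp hi, add_zero]

theorem polyBar_ne_zero [IsDedekindDomain A] {a : A} (ha : a ≠ 0) : φ.polyBar a ≠ 0 := by
  rw [polyBar, Ne, Polynomial.map_eq_zero]
  exact φ.toPoly_ne_zero ha

theorem coeff_one_polyBar_ne_zero {a : A} (ha : a ∉ RingHom.ker ι) : (φ.polyBar a).coeff 1 ≠ 0 := by
  rw [polyBar, coeff_map, φ.coeff_one]
  exact fun h => ha ((map_eq_zero _).mp h)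

variable {φ} in
theorem Points.smul_eq_zero_iff {a : A} {x : φ.Points} :
    a • x = 0 ↔ (φ.polyBar a).eval (Points.val x) = 0 := Iff.rfl

variable {φ} in
theorem AdjPoints.smul_eq_zero_iff {a : A} {y : φ.AdjPoints} :
    a • y = 0 ↔ adjoint Fq (φ.polyBar a) (AdjPoints.val y) = 0 := Iff.rfl

variable [IsDedekindDomain A]

/-- The pairings `⟨ , ⟩_{φ_a}` of `φ[a]` and `φ*[a]`. -/
def compatiblePairing : CompatiblePairing Fq (RingHom.ker ι) φ.Points φ.AdjPoints where
  pair a x y := pairingFq Fq (φ.polyBar a) (Points.val x) (AdjPoints.val y)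
  add_left a x x' y hx hx' hy := by
    have h := φ.isLinear_polyBar a
    apply (algebraMap Fq (AlgebraicClosure L)).injective
    have hxx : a • (x + x') = 0 := by rw [smul_add, hx, hx', add_zero]
    rw [_root_.map_add (algebraMap _ _), algebraMap_pairingFq h hx hy,
      algebraMap_pairingFq h hx' hy, algebraMap_pairingFq h hxx hy]
    exact pairing_add_left h hx hx' _
  add_right a x y y' hx hy hy' := by
    have h := φ.isLinear_polyBar a
    apply (algebraMap Fq (AlgebraicClosure L)).injective
    have hyy : a • (y + y') = 0 := by rw [smul_add, hy, hy', add_zero]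
    rw [_root_.map_add (algebraMap _ _), algebraMap_pairingFq h hx hy,
      algebraMap_pairingFq h hx hy', algebraMap_pairingFq h hx hyy]
    exact pairing_add_right _ _ _ _
  algebraMap_smul a c x y hx hy := by
    have h := φ.isLinear_polyBar a
    have e : Points.val (algebraMap Fq A c • x) =
        algebraMap Fq (AlgebraicClosure L) c * Points.val x := by
      rw [Points.val_smul, polyBar_algebraMap, eval_mul, eval_C, eval_X]
    apply (algebraMap Fq (AlgebraicClosure L)).injective
    rw [_root_.map_mul, algebraMap_pairingFq h hx hy, algebraMap_pairingFq h
      (Points.smul_eq_zero_iff.mp (CompatiblePairing.smul_smul_eq_zero _ hx)) hy, e,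
      pairing_algebraMap_mul_left h hx]
  mul_left a c x y hx hy := by
    apply (algebraMap Fq (AlgebraicClosure L)).injective
    rw [algebraMap_pairingFq (φ.isLinear_polyBar _)
        (Points.smul_eq_zero_iff.mp (CompatiblePairing.mul_smul_eq_zero c hx)) hy,
      algebraMap_pairingFq (φ.isLinear_polyBar a) hx
        (AdjPoints.smul_eq_zero_iff.mp (by rw [smul_smul, hy])), mul_comm, polyBar_mul,
      pairing_comp_of_eval_eq_zero (φ.isLinear_polyBar a) (φ.isLinear_polyBar c) hx]
    rfl
  mul_right a c x y hx hy := by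
    apply (algebraMap Fq (AlgebraicClosure L)).injective
    have hx' : a • c • x = 0 := by rw [smul_smul, hx]
    rw [algebraMap_pairingFq (φ.isLinear_polyBar _) hx
        (AdjPoints.smul_eq_zero_iff.mp (CompatiblePairing.mul_smul_eq_zero c hy)),
      algebraMap_pairingFq (φ.isLinear_polyBar a) hx' hy, polyBar_mul,
      pairing_comp_of_adjoint_eq_zero (φ.isLinear_polyBar a) (φ.isLinear_polyBar c) hx' hy]
    rfl
  nondeg_left a ha x hx h := by
    apply Points.val.injective
    refine eq_zero_of_pairing_eq_zero (φ.isLinear_polyBar a) (φ.coeff_one_polyBar_ne_zero ha) hx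
      fun y hy => ?_
    rw [← algebraMap_pairingFq (φ.isLinear_polyBar a) hx hy]
    exact (congrArg _ (h (AdjPoints.val.symm y) hy)).trans (_root_.map_zero _)
  nondeg_right a ha y hy h := by
    apply AdjPoints.val.injective
    refine eq_zero_of_pairing_eq_zero_right (φ.isLinear_polyBar a) (φ.coeff_one_polyBar_ne_zero ha)
      hy fun x hx => ?_
    rw [← algebraMap_pairingFq (φ.isLinear_polyBar a) hx hy]
    exact (congrArg _ (h (Points.val.symm x) hx)).trans (_root_.map_zero _)
  finite_left a ha := by
    refine Set.finite_of_ncard_ne_zero (s := {x : AlgebraicClosure L | (φ.polyBar a).eval x = 0}) ?_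
    have h0 : φ.polyBar a ≠ 0 := φ.polyBar_ne_zero fun h => ha (h ▸ zero_mem _)
    obtain ⟨d, hd⟩ := (φ.isLinear_polyBar a).exists_natDegree_eq h0
    rw [(φ.isLinear_polyBar a).ncard_eval_eq_zero (φ.coeff_one_polyBar_ne_zero ha), hd]
    exact pow_ne_zero _ Fintype.card_ne_zero
  finite_right a ha := by
    have h : {y : AlgebraicClosure L | adjoint Fq (φ.polyBar a) y = 0}.Finite :=
      finite_setOf_adjoint_eq_zero (φ.isLinear_polyBar a)
        (φ.polyBar_ne_zero fun h => ha (h ▸ zero_mem _))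
    exact h
  baer_left := baer_of_divisible fun a ha y =>
    (φ.isLinear_polyBar a).exists_eval_eq (φ.polyBar_ne_zero ha) (Points.val y)
  baer_right := baer_of_divisible fun a ha y =>
    (φ.isLinear_polyBar a).exists_adjoint_eq (φ.polyBar_ne_zero ha) (AdjPoints.val y)

theorem algebraMap_compatiblePairing {a : A} {x : φ.Points} {y : φ.AdjPoints} (hx : a • x = 0)
    (hy : a • y = 0) : algebraMap Fq (AlgebraicClosure L) (φ.compatiblePairing.pair a x y) =
      φ.torsionPairing a x y :=
  algebraMap_pairingFq (φ.isLinear_polyBar a) hx hy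

theorem compatiblePairing_galois (σ : AlgebraicClosure L ≃ₐ[L] AlgebraicClosure L) {a : A}
    {x : φ.Points} {y : φ.AdjPoints} (hx : a • x = 0) (hy : a • y = 0) :
    φ.compatiblePairing.pair a (σ • x) (σ • y) = φ.compatiblePairing.pair a x y := by
  apply (algebraMap Fq (AlgebraicClosure L)).injective
  rw [φ.algebraMap_compatiblePairing (by rw [smul_comm, hx, smul_zero])
    (by rw [smul_comm, hy, smul_zero])]
  have hσ : (φ.polyBar a).map (σ : AlgebraicClosure L →+* AlgebraicClosure L) = φ.polyBar a := by
    rw [polyBar, Polynomial.map_map]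
    congr 1
    exact RingHom.ext σ.commutes
  change pairing Fq (φ.polyBar a) (σ (Points.val x)) (σ (AdjPoints.val y)) = _
  rw [pairing_map_apply σ (φ.isLinear_polyBar a) hσ hx]
  change σ (φ.torsionPairing a x y) = _
  rw [← φ.algebraMap_compatiblePairing hx hy,
    IsScalarTower.algebraMap_apply Fq L (AlgebraicClosure L), AlgEquiv.commutes]

end DrinfeldModule

/-! ### Homomorphisms out of `K_𝔮 / A_𝔮` as inverse limits -/

section InverseLimit

variable {A : Type*} [CommRing A] [IsDedekindDomain A] {K : Type*} [Field K] [Algebra A K]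
  [IsFractionRing A K] {v : HeightOneSpectrum A} {a : A} {m : ℕ}

theorem ne_zero_of_span_singleton_eq_pow (ha : Ideal.span {a} = v.asIdeal ^ m) : a ≠ 0 := by
  rintro rfl
  rw [Ideal.span_singleton_eq_bot.mpr rfl] at ha
  exact pow_ne_zero m v.ne_bot ha.symm

namespace KmodA

theorem exists_smul_invClass_pow_eq (hm : 0 < m) (ha : Ideal.span {a} = v.asIdeal ^ m)
    (b : KmodA K v) : ∃ (n : ℕ) (c : A), c • invClass K v (a ^ n) = b := by
  obtain ⟨n, hn⟩ := exists_pow_smul_eq_zero b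
  have han : a ^ n ∈ v.asIdeal ^ n := by
    refine Ideal.pow_mem_pow ?_ n
    have : a ∈ v.asIdeal ^ m := ha ▸ Ideal.mem_span_singleton_self a
    exact Ideal.pow_le_self hm.ne' this
  exact ⟨n, exists_smul_invClass_eq (pow_ne_zero n (ne_zero_of_span_singleton_eq_pow ha))
    (hn _ han)⟩

theorem pow_dvd_of_smul_invClass_pow_eq_zero (ha : Ideal.span {a} = v.asIdeal ^ m) {n : ℕ} {c : A}
    (h : c • invClass K v (a ^ n) = 0) : a ^ n ∣ c := by
  have hspan : Ideal.span {a ^ n} = v.asIdeal ^ (m * n) := by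
    rw [← Ideal.span_singleton_pow, ha, ← pow_mul]
  have h1 : a ^ n ∈ v.asIdeal ^ (m * n) := hspan ▸ Ideal.mem_span_singleton_self _
  have h2 : a ^ n ∉ v.asIdeal ^ (m * n + 1) := by
    rw [← Ideal.span_singleton_le_iff_mem, hspan]
    exact (Ideal.pow_succ_lt_pow (P := v.asIdeal) v.ne_bot (m * n)).not_ge
  rwa [smul_invClass_eq_zero_iff_mem_pow h1 h2, ← hspan, Ideal.mem_span_singleton] at h

theorem pow_mul_smul_invClass_pow_add (ha : a ≠ 0) (n k : ℕ) (c : A) :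
    (a ^ k * c) • invClass K v (a ^ (n + k)) = c • invClass K v (a ^ n) := by
  rw [mul_comm, mul_smul, pow_add, smul_invClass_mul _ (pow_ne_zero k ha)]

variable {S : Type*} [CommRing S] [Algebra S A] [Module S (KmodA K v)]
  [IsScalarTower S A (KmodA K v)] {N : Type*} [AddCommGroup N] [Module S N]

/-- `K_𝔮 / A_𝔮` is the direct limit of the modules `a^(-n) A / A ≅ A / a^n`. -/
theorem exists_linearMap_smul_invClass_pow (hm : 0 < m) (ha : Ideal.span {a} = v.asIdeal ^ m)
    (l : ℕ → A →ₗ[S] N) (hl : ∀ n c, l n (a ^ n * c) = 0 ∧ l (n + 1) (a * c) = l n c) :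
    ∃ f : HomKmodA K v S N, ∀ n c, f (c • invClass K v (a ^ n)) = l n c := by
  have ha0 := ne_zero_of_span_singleton_eq_pow ha
  have hstep : ∀ n k c, l (n + k) (a ^ k * c) = l n c := by
    intro n k
    induction k with
    | zero => intro c; rw [pow_zero, one_mul, add_zero]
    | succ k ih => intro c; rw [pow_succ', mul_assoc, ← add_assoc, (hl _ _).2, ih]
  have hwd : ∀ n c n' c', c • invClass K v (a ^ n) = c' • invClass K v (a ^ n') →
      l n c = l n' c' := by
    intro n c n' c' h
    rw [← pow_mul_smul_invClass_pow_add ha0 n n' c, ← pow_mul_smul_invClass_pow_add ha0 n' n c',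
      add_comm n' n, ← sub_eq_zero, ← sub_smul] at h
    obtain ⟨r, hr⟩ := pow_dvd_of_smul_invClass_pow_eq_zero ha h
    rw [← hstep n n' c, ← hstep n' n c', add_comm n' n, ← sub_eq_zero, ← map_sub, hr, (hl _ _).1]
  choose n c hnc using exists_smul_invClass_pow_eq (K := K) hm ha
  have key : ∀ k d, l (n (d • invClass K v (a ^ k))) (c (d • invClass K v (a ^ k))) = l k d :=
    fun k d => hwd _ _ _ _ (hnc _)
  refine ⟨HomKmodA.ofLinearMap ⟨⟨fun b => l (n b) (c b), fun b b' => ?_⟩, fun s b => ?_⟩, key⟩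
  · obtain ⟨k, d, rfl⟩ := exists_smul_invClass_pow_eq hm ha b
    obtain ⟨k', d', rfl⟩ := exists_smul_invClass_pow_eq hm ha b'
    rw [← pow_mul_smul_invClass_pow_add ha0 k k' d, ← pow_mul_smul_invClass_pow_add ha0 k' k d',
      add_comm k' k, ← add_smul, key, key, key, map_add]
  · obtain ⟨k, d, rfl⟩ := exists_smul_invClass_pow_eq hm ha b
    change l (n (s • d • invClass K v (a ^ k))) (c (s • d • invClass K v (a ^ k))) =
      s • l (n (d • invClass K v (a ^ k))) (c (d • invClass K v (a ^ k)))
    rw [← smul_assoc, key, key, map_smul]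

end KmodA

theorem bijOn_torsionLimit (N : Type*) [AddCommGroup N] [Module A N] (hm : 0 < m)
    (ha : Ideal.span {a} = v.asIdeal ^ m) :
    Set.BijOn (fun (α : HomKmodA K v A N) (n : ℕ) => α (invClass K v (a ^ n))) Set.univ
      (torsionLimit N a) := by
  have ha0 := ne_zero_of_span_singleton_eq_pow ha
  refine ⟨fun α _ n => ⟨?_, ?_⟩, fun α _ α' _ h => DFunLike.ext _ _ fun b => ?_, fun x hx => ?_⟩
  · rw [← map_smul, KmodA.smul_invClass_self, map_zero]
  · rw [← map_smul, pow_succ, KmodA.smul_invClass_mul _ ha0]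
  · obtain ⟨n, c, rfl⟩ := KmodA.exists_smul_invClass_pow_eq hm ha b
    rw [map_smul, map_smul]
    exact congrArg (c • ·) (congrFun h n)
  · obtain ⟨α, hα⟩ := KmodA.exists_linearMap_smul_invClass_pow (K := K) hm ha
      (fun n => LinearMap.toSpanSingleton A N (x n)) (fun n c => by
        simp only [LinearMap.toSpanSingleton_apply]
        constructor
        · rw [mul_comm, mul_smul, (hx n).1, smul_zero]
        · rw [mul_comm, mul_smul, (hx n).2])
    refine ⟨α, Set.mem_univ α, funext fun n => ?_⟩
    have := hα n 1
    rwa [one_smul, LinearMap.toSpanSingleton_apply, one_smul] at this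

theorem bijOn_dualLimit (Fq : Type*) [Field Fq] [Algebra Fq A] (hm : 0 < m)
    (ha : Ideal.span {a} = v.asIdeal ^ m) :
    Set.BijOn (fun (μ : FqDual K v Fq) (n : ℕ) => μ.pullback (invClass K v (a ^ n))) Set.univ
      (dualLimit Fq a) := by
  have ha0 := ne_zero_of_span_singleton_eq_pow ha
  have hpull : ∀ (μ : FqDual K v Fq) (b : KmodA K v) (c : A), μ.pullback b c = μ (c • b) :=
    fun _ _ _ => rfl
  refine ⟨fun μ _ n c => ⟨?_, ?_⟩, fun μ _ μ' _ h => DFunLike.ext _ _ fun b => ?_, fun x hx => ?_⟩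
  · rw [hpull, mul_comm, mul_smul, KmodA.smul_invClass_self, smul_zero, map_zero]
  · rw [hpull, hpull, mul_comm, mul_smul, pow_succ, KmodA.smul_invClass_mul _ ha0]
  · obtain ⟨n, c, rfl⟩ := KmodA.exists_smul_invClass_pow_eq hm ha b
    exact LinearMap.congr_fun (congrFun h n) c
  · obtain ⟨μ, hμ⟩ := KmodA.exists_linearMap_smul_invClass_pow (K := K) hm ha x hx
    exact ⟨μ, Set.mem_univ μ, funext fun n => LinearMap.ext fun c => hμ n c⟩

end InverseLimit

/-! ### Finiteness of the residue rings of `A` -/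

section ResidueRings

open scoped IntermediateField.algebraAdjoinAdjoin
open IntermediateField

/-- In a function field of one variable every transcendental element can serve as the variable. -/
theorem finiteDimensional_adjoin_of_transcendental {k K : Type*} [Field k] [Field K] [Algebra k K]
    {t₀ t : K} [FiniteDimensional k⟮t₀⟯ K] (ht : Transcendental k t) :
    FiniteDimensional k⟮t⟯ K := by
  -- `K` has transcendence degree at most one, so `t` is a transcendence basis.
  have h1 : Algebra.IsAlgebraic (Algebra.adjoin k {t₀}) K :=
    (IsFractionRing.comap_isAlgebraic_iff (A := Algebra.adjoin k {t₀}) (K := k⟮t₀⟯)).mpr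
      inferInstance
  have h2 := Algebra.IsAlgebraic.trdeg_le_cardinalMk k ({t₀} : Set K)
  have h3 : AlgebraicIndependent k (fun _ : Unit => t) :=
    algebraicIndependent_unique_type_iff.mpr ht
  have h4 : IsTranscendenceBasis k (fun _ : Unit => t) :=
    h3.isTranscendenceBasis_of_lift_trdeg_le_of_finite (by simpa using h2)
  have h5 := h4.isAlgebraic_field
  have h6 : Algebra.EssFiniteType k k⟮t₀⟯ :=
    IntermediateField.essFiniteType_iff.mpr
      (IntermediateField.fg_adjoin_of_finite (Set.finite_singleton _))
  have h7 : Algebra.EssFiniteType k K := Algebra.EssFiniteType.comp k k⟮t₀⟯ K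
  have h8 : Algebra.EssFiniteType k⟮t⟯ K := Algebra.EssFiniteType.of_comp k k⟮t⟯ K
  have h9 : Set.range (fun _ : Unit => t) = {t} := by simp
  rw [h9] at h5
  exact Algebra.finite_of_essFiniteType_of_isAlgebraic

/-- `k(t)` is the fraction field of `k[t]`. -/
theorem linearIndependent_adjoin_iff {k K ι : Type*} [Field k] [Field K] [Algebra k K] {t : K}
    {b : ι → K} : LinearIndependent (Algebra.adjoin k {t}) b ↔ LinearIndependent k⟮t⟯ b :=
  LinearIndependent.iff_fractionRing (Algebra.adjoin k {t}) k⟮t⟯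

variable {k A K : Type*} [Field k] [CommRing A] [IsDomain A] [Algebra k A] [Field K] [Algebra A K]
  [IsFractionRing A K] [Algebra k K] [IsScalarTower k A K]

/-- If `t ∈ I`, then elements of `A` that are `k`-linearly independent modulo `I` are linearly
independent over `k[t]`: reduce a relation modulo `I` to see that the constant coefficients vanish,
divide by `t`, and repeat. -/
theorem linearIndependent_adjoin_of_mk {I : Ideal A} {t : A} (ht : t ∈ I) (ht0 : t ≠ 0)
    {ι : Type*} (x : ι → A) (hx : LinearIndependent k fun i => Ideal.Quotient.mk I (x i)) :
    LinearIndependent (Algebra.adjoin k {algebraMap A K t}) fun i => algebraMap A K (x i) := by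
  have h0 : ∀ (s : Finset ι) (p : ι → k[X]), ∑ i ∈ s, aeval t (p i) * x i = 0 →
      ∀ i ∈ s, (p i).coeff 0 = 0 := by
    intro s p hp
    refine linearIndependent_iff'.mp hx s (fun i => (p i).coeff 0) ?_
    rw [← map_zero (Ideal.Quotient.mk I), ← hp, map_sum]
    refine Finset.sum_congr rfl fun i _ => ?_
    rw [Algebra.smul_def, map_mul]
    congr 1
    rw [← Ideal.Quotient.mk_algebraMap, Ideal.Quotient.eq, ← neg_mem_iff, neg_sub]
    have h1 : aeval t (p i) - algebraMap k A ((p i).coeff 0) = aeval t (p i).divX * t := by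
      nth_rewrite 1 [← divX_mul_X_add (p i)]
      simp
    rw [h1]
    exact I.mul_mem_left _ ht
  have key : ∀ (s : Finset ι) (n : ℕ) (p : ι → k[X]), ∑ i ∈ s, aeval t (p i) * x i = 0 →
      ∀ i ∈ s, (p i).coeff n = 0 := by
    intro s n
    induction n with
    | zero => exact h0 s
    | succ n ih =>
      intro p hp i hi
      rw [← coeff_divX]
      refine ih (fun i => (p i).divX) ?_ i hi
      refine (mul_eq_zero.mp ?_).resolve_left ht0
      rw [← hp, Finset.mul_sum]
      refine Finset.sum_congr rfl fun i hi => ?_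
      conv_rhs => rw [← divX_mul_X_add (p i), h0 s p hp i hi]
      simp only [map_zero, add_zero, map_mul, aeval_X]
      ring
  rw [linearIndependent_iff']
  intro s g hg i hi
  have h1 : ∀ i, ∃ p : k[X], aeval (algebraMap A K t) p = (g i : K) := by
    intro i
    exact (Algebra.adjoin_singleton_eq_range_aeval k (algebraMap A K t)).le (g i).2
  choose p hp using h1
  have h2 : ∑ i ∈ s, aeval t (p i) * x i = 0 := by
    apply IsFractionRing.injective A K
    rw [map_sum, map_zero, ← hg]
    refine Finset.sum_congr rfl fun i _ => ?_
    rw [map_mul, ← aeval_algebraMap_apply, hp]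
    rfl
  have h3 : p i = 0 := Polynomial.ext fun n => by simpa using key s n p h2 i hi
  ext
  rw [← hp, h3]
  simp

/-- If `K` is finite over a rational function field in one variable over `k`, then the proper
quotients of `A` are finite-dimensional over `k`. -/
theorem finite_quotient_of_ne_bot {t₀ : K} [FiniteDimensional k⟮t₀⟯ K] {I : Ideal A} (hI : I ≠ ⊥) :
    Module.Finite k (A ⧸ I) := by
  obtain ⟨t, ht, ht0⟩ := Submodule.exists_mem_ne_zero_of_ne_bot hI
  by_cases htop : I = ⊤
  · have : Subsingleton (A ⧸ I) := Ideal.Quotient.subsingleton_iff.mpr htop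
    exact Module.Finite.of_finite
  -- a nonzero algebraic element of the domain `A` is a unit, and `I` contains no unit
  have htr : Transcendental k (algebraMap A K t) := by
    intro halg
    have h1 : IsIntegral k t :=
      ((isAlgebraic_algebraMap_iff (IsFractionRing.injective A K)).mp halg).isIntegral
    exact htop (Ideal.eq_top_of_isUnit_mem _ ht (h1.isUnit ht0))
  have hfin : FiniteDimensional k⟮algebraMap A K t⟯ K :=
    finiteDimensional_adjoin_of_transcendental (t₀ := t₀) htr
  rw [← Module.rank_lt_aleph0_iff]
  refine lt_of_le_of_lt (rank_le (n := Module.finrank k⟮algebraMap A K t⟯ K) fun s hs => ?_)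
    Cardinal.natCast_lt_aleph0
  choose x hx using fun i : A ⧸ I => Ideal.Quotient.mk_surjective i
  have h1 : LinearIndependent k fun i : s => Ideal.Quotient.mk I (x i) := by
    simpa only [hx] using hs
  have h2 := linearIndependent_adjoin_iff.mp
    (linearIndependent_adjoin_of_mk (K := K) ht ht0 _ h1)
  simpa using h2.fintype_card_le_finrank

end ResidueRings

/-! ### Compactness of `A_𝔮` -/

section Compact

open WithZero

variable {A : Type*} [CommRing A] [IsDedekindDomain A] (K : Type*) [Field K] [Algebra A K]
  [IsFractionRing A K] (v : HeightOneSpectrum A)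

/-- `A_𝔮` is closed in the complete field `K_𝔮`, and it is covered by the finitely many cosets of
`𝔮ⁿ A_𝔮`, which have representatives in `A`. -/
theorem compactSpace_adicCompletionIntegers (hfin : ∀ n : ℕ, Finite (A ⧸ v.asIdeal ^ n)) :
    CompactSpace (v.adicCompletionIntegers K) := by
  refine isCompact_iff_compactSpace
    (s := (v.adicCompletionIntegers K : Set (v.adicCompletion K))).mp
    (isCompact_iff_totallyBounded_isComplete.mpr ?_)
  refine ⟨?_, (Valued.isClosed_valuationSubring _).isComplete⟩
  rw [totallyBounded_iff_subset_finite_iUnion_nhds_zero]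
  intro U hU
  obtain ⟨γ, hγ⟩ := Valued.mem_nhds_zero.mp hU
  obtain ⟨n, hn⟩ := WithZero.exists_exp_neg_natCast_lt
    (x := MonoidWithZeroHom.ValueGroup₀.embedding γ.val) (by simp)
  choose r hr using fun c : A ⧸ v.asIdeal ^ n => Ideal.Quotient.mk_surjective c
  refine ⟨Set.range fun c => algebraMap A (v.adicCompletion K) (r c), Set.finite_range _,
    fun s hs => ?_⟩
  obtain ⟨c, hc⟩ := KmodA.exists_valued_sub_le ⟨s, hs⟩ n
  refine Set.mem_iUnion₂.mpr ⟨_, ⟨Ideal.Quotient.mk _ c, rfl⟩, ?_⟩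
  rw [Set.mem_vadd_set_iff_neg_vadd_mem, vadd_eq_add]
  refine hγ ?_
  rw [Set.mem_ofPred_eq, Valuation.restrict_lt_iff_lt_embedding]
  refine lt_of_le_of_lt ?_ hn
  have h1 : c - r (Ideal.Quotient.mk _ c) ∈ v.asIdeal ^ n := by
    rw [← Ideal.Quotient.eq, hr]
  have h2 : -(algebraMap A (v.adicCompletion K) (r (Ideal.Quotient.mk _ c))) + s =
      (s - algebraMap A (v.adicCompletion K) c) +
        algebraMap A (v.adicCompletion K) (c - r (Ideal.Quotient.mk _ c)) := by
    rw [map_sub]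
    ring
  rw [h2]
  refine (Valuation.map_add _ _ _).trans (max_le hc ?_)
  rw [valued_algebraMap]
  exact (v.intValuation_le_pow_iff_mem _ n).mpr h1

end Compact

/-! ### The `F_q`-dual of `K_𝔮 / A_𝔮` is free of rank one -/

section Dual

attribute [local instance] KmodA.moduleFq KmodA.smulCommClassFq

variable {A : Type*} [CommRing A] [IsDedekindDomain A] {K : Type*} [Field K] [Algebra A K]
  [IsFractionRing A K] {v : HeightOneSpectrum A} {Fq : Type*} [Field Fq] [Algebra Fq A]

namespace FqDual

open WithZero

/-- A functional that does not vanish on the socle of `K_𝔮 / A_𝔮` is nonzero on every nonzero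
`A`-submodule, because such a submodule contains the socle. -/
theorem eq_zero_of_forall_apply_smul_eq_zero {a₁ : A} (ha₁ : a₁ ∈ v.asIdeal ^ 1)
    (ha₁' : a₁ ∉ v.asIdeal ^ (1 + 1)) {μ₀ : FqDual K v Fq} (hμ₀ : μ₀ (invClass K v a₁) ≠ 0)
    {b : KmodA K v} (hb : ∀ d : A, μ₀ (d • b) = 0) : b = 0 := by
  by_contra hb0
  obtain ⟨x, rfl⟩ := KmodA.mk_surjective b
  rw [KmodA.mk_eq_zero_iff, not_le] at hb0
  have hx0 : Valued.v x ≠ 0 := (lt_trans zero_lt_one hb0).ne'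
  have hx : exp (1 : ℤ) ≤ Valued.v x := by
    rw [← exp_log hx0, ← exp_zero, exp_lt_exp] at hb0
    rw [← exp_log hx0, exp_le_exp]
    omega
  have hxne : x ≠ 0 := fun h => hx0 (by rw [h, map_zero])
  -- `a₁⁻¹ / x` is integral, so the class of `a₁⁻¹` is a multiple of that of `x`.
  have hs : Valued.v ((algebraMap A (v.adicCompletion K) a₁)⁻¹ / x) ≤ 1 := by
    rw [map_div₀, map_inv₀, valued_algebraMap, intValuation_eq_exp_neg ha₁ ha₁', ← exp_neg,
      neg_neg]
    exact div_le_one_of_le₀ (by simpa using hx) _root_.zero_le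
  obtain ⟨n, hn⟩ := KmodA.exists_pow_smul_eq_zero (KmodA.mk K v x)
  obtain ⟨c, hc⟩ := KmodA.exists_smul_eq_smul
    (⟨(algebraMap A (v.adicCompletion K) a₁)⁻¹ / x, hs⟩ : v.adicCompletionIntegers K) n
  apply hμ₀
  rw [← hb c, ← hc _ hn, KmodA.integers_smul_mk, KmodA.invClass_eq_mk, div_mul_cancel₀ _ hxne]

/-- Modulo `𝔮ⁿ` every functional is a multiple of `μ₀`: the bilinear form `(c, d) ↦ μ₀(c d bₙ)` on
the finite-dimensional space `A/𝔮ⁿ` is nondegenerate. -/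
theorem exists_apply_smul_invClass_eq {a₁ : A} (ha₁ : a₁ ∈ v.asIdeal ^ 1)
    (ha₁' : a₁ ∉ v.asIdeal ^ (1 + 1)) {μ₀ : FqDual K v Fq} (hμ₀ : μ₀ (invClass K v a₁) ≠ 0)
    {a : A} {n : ℕ} [Module.Finite Fq (A ⧸ v.asIdeal ^ n)] (ha : a ∈ v.asIdeal ^ n)
    (ha' : a ∉ v.asIdeal ^ (n + 1)) (μ : FqDual K v Fq) :
    ∃ c : A, ∀ d : A, μ₀ (c • d • invClass K v a) = μ (d • invClass K v a) := by
  have hker := KmodA.smul_invClass_eq_zero_iff_mem_pow (K := K) ha ha'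
  let e : (A ⧸ v.asIdeal ^ n) →ₗ[A] KmodA K v :=
    (v.asIdeal ^ n).liftQ (LinearMap.toSpanSingleton A _ (invClass K v a))
      fun c hc => (hker c).mpr hc
  let l : FqDual K v Fq → (A ⧸ v.asIdeal ^ n) →ₗ[Fq] Fq := fun μ =>
    LinearMap.comp (μ : KmodA K v →ₗ[Fq] Fq) (e.restrictScalars Fq)
  have hl : ∀ (μ : FqDual K v Fq) (d : A),
      l μ (Ideal.Quotient.mk _ d) = μ (d • invClass K v a) := fun _ _ => rfl
  let B := (LinearMap.mul Fq (A ⧸ v.asIdeal ^ n)).compr₂ (l μ₀)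
  have hB : ∀ c d : A, B (Ideal.Quotient.mk _ c) (Ideal.Quotient.mk _ d) =
      μ₀ ((c * d) • invClass K v a) := fun _ _ => rfl
  have hinj : Function.Injective B := by
    rw [injective_iff_map_eq_zero]
    intro c hc
    obtain ⟨c, rfl⟩ := Ideal.Quotient.mk_surjective c
    rw [Ideal.Quotient.eq_zero_iff_mem, ← hker]
    refine eq_zero_of_forall_apply_smul_eq_zero ha₁ ha₁' hμ₀ fun d => ?_
    rw [smul_smul, mul_comm, ← hB, hc, LinearMap.zero_apply]
  obtain ⟨c, hc⟩ := (LinearMap.injective_iff_surjective_of_finrank_eq_finrank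
    (Subspace.dual_finrank_eq).symm).mp hinj (l μ)
  obtain ⟨c, rfl⟩ := Ideal.Quotient.mk_surjective c
  refine ⟨c, fun d => ?_⟩
  rw [← hl, ← hc, hB, smul_smul]

/-- `s ↦ s • μ₀` is continuous from the `𝔮`-adic topology to that of pointwise convergence. -/
theorem continuous_smul_left (μ₀ : FqDual K v Fq) :
    Continuous fun s : v.adicCompletionIntegers K => s • μ₀ := by
  refine HomKmodA.continuous_of_locally_const fun b s₀ => ?_
  obtain ⟨y, rfl⟩ := KmodA.mk_surjective b
  by_cases hy : y = 0
  · refine ⟨Set.univ, isOpen_univ, trivial, fun s _ => ?_⟩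
    rw [HomKmodA.smul_apply, HomKmodA.smul_apply, KmodA.integers_smul_mk, KmodA.integers_smul_mk,
      hy, mul_zero, mul_zero]
  refine ⟨(fun s : v.adicCompletionIntegers K => (s : v.adicCompletion K) - s₀) ⁻¹'
    {z | Valued.v z ≤ Valued.v y⁻¹}, (KmodA.isOpen_valued_le (inv_ne_zero hy)).preimage
      (by fun_prop), by simp, fun s hs => ?_⟩
  rw [HomKmodA.smul_apply, HomKmodA.smul_apply, ← sub_eq_zero, ← map_sub, KmodA.integers_smul_mk,
    KmodA.integers_smul_mk, ← KmodA.mk_sub, ← sub_mul]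
  rw [(KmodA.mk_eq_zero_iff _).mpr, map_zero]
  rw [map_mul]
  refine (mul_le_mul_left hs _).trans ?_
  rw [← map_mul, inv_mul_cancel₀ hy, map_one]

/-- The isomorphism is `s ↦ s • μ₀` for a functional `μ₀` that is nonzero on the socle. It is onto
because `A_𝔮` is compact and each restriction to a `𝔮ⁿ`-torsion submodule is a multiple of
`μ₀`. -/
theorem nonempty_continuousLinearEquiv [CompactSpace (v.adicCompletionIntegers K)]
    [∀ n : ℕ, Module.Finite Fq (A ⧸ v.asIdeal ^ n)] :
    Nonempty (FqDual K v Fq ≃L[v.adicCompletionIntegers K] v.adicCompletionIntegers K) := by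
  choose a ha ha' ha0 using fun n => exists_mem_pow_not_mem_pow_succ_not_mem v ⊥ v.ne_bot n
  have hker : ∀ n c, c • invClass K v (a n) = 0 ↔ c ∈ v.asIdeal ^ n := fun n =>
    KmodA.smul_invClass_eq_zero_iff_mem_pow (K := K) (ha n) (ha' n)
  have h1 : invClass K v (a 1) ≠ 0 := by
    intro h
    have h2 := (hker 1 1).mp (by rw [h, smul_zero])
    rw [pow_one, ← Ideal.eq_top_iff_one] at h2
    exact v.isPrime.ne_top h2
  obtain ⟨μ₀, hμ₀⟩ : ∃ μ₀ : FqDual K v Fq, μ₀ (invClass K v (a 1)) ≠ 0 := by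
    by_contra! h
    exact h1 ((Module.forall_dual_apply_eq_zero_iff Fq _).mp fun f => h (HomKmodA.ofLinearMap f))
  let Θ : v.adicCompletionIntegers K →ₗ[v.adicCompletionIntegers K] FqDual K v Fq :=
    LinearMap.toSpanSingleton _ _ μ₀
  have hΘ : Continuous Θ := continuous_smul_left μ₀
  have hΘapp : ∀ s b, Θ s b = μ₀ (s • b) := fun _ _ => rfl
  have hinj : Function.Injective Θ := by
    rw [injective_iff_map_eq_zero]
    intro s hs
    by_contra hs0
    have hs0' : (s : v.adicCompletion K) ≠ 0 := fun h => hs0 (Subtype.ext h)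
    apply hμ₀
    have h3 := DFunLike.congr_fun hs
      (KmodA.mk K v ((s : v.adicCompletion K)⁻¹ * (algebraMap A (v.adicCompletion K) (a 1))⁻¹))
    rwa [hΘapp, KmodA.integers_smul_mk, mul_inv_cancel_left₀ hs0', ← KmodA.invClass_eq_mk] at h3
  have hsurj : Function.Surjective Θ := by
    intro μ
    -- `S n` consists of the `s` for which `s • μ₀` and `μ` agree on the `𝔮ⁿ`-torsion.
    let S : ℕ → Set (v.adicCompletionIntegers K) := fun n =>
      {s | ∀ d : A, Θ s (d • invClass K v (a n)) = μ (d • invClass K v (a n))}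
    have hnonempty : (⋂ n, S n).Nonempty := by
      have hclosed : ∀ n, IsClosed (S n) := by
        intro n
        have : S n = ⋂ d : A, Θ ⁻¹'
            {f | f (d • invClass K v (a n)) = μ (d • invClass K v (a n))} := by
          ext s
          simp [S]
        rw [this]
        refine isClosed_iInter fun d => IsClosed.preimage hΘ ⟨?_⟩
        have : {f : FqDual K v Fq | f (d • invClass K v (a n)) = μ (d • invClass K v (a n))}ᶜ =
            ⋃ y ∈ {y | y ≠ μ (d • invClass K v (a n))},
              {f : FqDual K v Fq | f (d • invClass K v (a n)) = y} := by
          ext f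
          simp
        rw [this]
        exact isOpen_biUnion fun y _ => HomKmodA.isOpen_setOf_apply_eq _ y
      refine IsCompact.nonempty_iInter_of_sequence_nonempty_isCompact_isClosed S ?_ ?_
        (hclosed 0).isCompact hclosed
      · intro n s hs d
        obtain ⟨c, hc⟩ := KmodA.exists_smul_invClass_eq (ha0 (n + 1)) (b := invClass K v (a n))
          ((hker n _).mpr (Ideal.pow_le_pow_right n.le_succ (ha (n + 1))))
        rw [← hc, smul_smul]
        exact hs (d * c)
      · intro n
        obtain ⟨c, hc⟩ := exists_apply_smul_invClass_eq (ha 1) (ha' 1) hμ₀ (ha n) (ha' n) μ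
        refine ⟨algebraMap A _ c, fun d => ?_⟩
        rw [hΘapp, KmodA.algebraMap_smul_eq, hc]
    obtain ⟨s, hs⟩ := hnonempty
    refine ⟨s, DFunLike.ext _ _ fun b => ?_⟩
    obtain ⟨n, hn⟩ := KmodA.exists_pow_smul_eq_zero b
    obtain ⟨c, rfl⟩ := KmodA.exists_smul_invClass_eq (ha0 n) (hn _ (ha n))
    exact Set.mem_iInter.mp hs n c
  let E := LinearEquiv.ofBijective Θ ⟨hinj, hsurj⟩
  have hE : Continuous E.toEquiv := hΘ
  exact ⟨({ E with
    continuous_toFun := hΘ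
    continuous_invFun := hE.homeoOfEquivCompactToT2.symm.continuous } :
      v.adicCompletionIntegers K ≃L[v.adicCompletionIntegers K] FqDual K v Fq).symm⟩

end FqDual

end Dual

end DrinfeldTate

end

theorem mainTheorem12
    {Fq : Type*} [Field Fq] [Fintype Fq]
    {A : Type*} [CommRing A] [IsDedekindDomain A] [Algebra Fq A]
    {K : Type*} [Field K] [Algebra A K] [IsFractionRing A K] [Algebra Fq K] [IsScalarTower Fq A K]
    (_hA : DrinfeldTate.IsRegularAwayFromPoint Fq A K)
    {L : Type*} [Field L] [Algebra Fq L] (ι : A →ₐ[Fq] L)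
    (φ : DrinfeldTate.DrinfeldModule Fq ι)
    (v : HeightOneSpectrum A) (_hv : v.asIdeal ≠ RingHom.ker ι) :
    ∃ B : φ.TateModule K v →ₗ[v.adicCompletionIntegers K]
        φ.AdjTateModule K v →ₗ[v.adicCompletionIntegers K] DrinfeldTate.FqDual K v Fq,
      -- explicit description of the pairing
      (∀ (α : φ.TateModule K v) (β : φ.AdjTateModule K v) (b : DrinfeldTate.KmodA K v) (a : A),
        a ≠ 0 → a • b = 0 →
          algebraMap Fq (AlgebraicClosure L) (B α β b) =
            φ.torsionPairing a (α b) (β (DrinfeldTate.invClass K v a))) ∧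
      -- the pairing is continuous
      Continuous (fun p : φ.TateModule K v × φ.AdjTateModule K v => B p.1 p.2) ∧
      -- the pairing is Galois-equivariant, the action on the target being trivial
      (∀ (σ : AlgebraicClosure L ≃ₐ[L] AlgebraicClosure L) (α : φ.TateModule K v)
        (β : φ.AdjTateModule K v), B (σ • α) (σ • β) = B α β) ∧
      -- the pairing is perfect
      Function.Bijective B ∧ Function.Bijective B.flip ∧
      -- the pairing is the inverse limit of the pairings `[ , ]_{a^n}`
      (∀ (a : A) (m : ℕ), 0 < m → Ideal.span {a} = v.asIdeal ^ m →
        Set.BijOn (fun (α : φ.TateModule K v) (n : ℕ) => α (DrinfeldTate.invClass K v (a ^ n)))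
          Set.univ (DrinfeldTate.torsionLimit φ.Points a) ∧
        Set.BijOn (fun (β : φ.AdjTateModule K v) (n : ℕ) => β (DrinfeldTate.invClass K v (a ^ n)))
          Set.univ (DrinfeldTate.torsionLimit φ.AdjPoints a) ∧
        Set.BijOn (fun (μ : DrinfeldTate.FqDual K v Fq) (n : ℕ) =>
            μ.pullback (DrinfeldTate.invClass K v (a ^ n)))
          Set.univ (DrinfeldTate.dualLimit Fq a) ∧
        ∀ (α : φ.TateModule K v) (β : φ.AdjTateModule K v) (n : ℕ) (c : A),
          algebraMap Fq (AlgebraicClosure L)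
              ((B α β).pullback (DrinfeldTate.invClass K v (a ^ n)) c) =
            φ.torsionPairing (a ^ n) (c • α (DrinfeldTate.invClass K v (a ^ n)))
              (β (DrinfeldTate.invClass K v (a ^ n)))) ∧
      -- the target is free of rank one
      Nonempty (DrinfeldTate.FqDual K v Fq ≃L[v.adicCompletionIntegers K]
        v.adicCompletionIntegers K) := by
  obtain ⟨⟨t₀, -, hfin⟩, -⟩ := _hA
  have hquot : ∀ n : ℕ, Module.Finite Fq (A ⧸ v.asIdeal ^ n) := fun n =>
    DrinfeldTate.finite_quotient_of_ne_bot (K := K) (t₀ := t₀) (pow_ne_zero n v.ne_bot)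
  have hcompact : CompactSpace (v.adicCompletionIntegers K) :=
    DrinfeldTate.compactSpace_adicCompletionIntegers K v fun n => Module.finite_of_finite Fq
  have hprime : (RingHom.ker ι).IsPrime := RingHom.ker_isPrime _
  let D := φ.compatiblePairing
  have hexpl : ∀ (α : φ.TateModule K v) (β : φ.AdjTateModule K v) (b : DrinfeldTate.KmodA K v)
      (a : A), a ≠ 0 → a • b = 0 → algebraMap Fq (AlgebraicClosure L) (D.limit α β b) =
        φ.torsionPairing a (α b) (β (DrinfeldTate.invClass K v a)) := by
    intro α β b a ha hab
    rw [D.limit_apply_eq_pair α β ha hab]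
    refine φ.algebraMap_compatiblePairing ?_ ?_
    · rw [← map_smul, hab, map_zero]
    · rw [← map_smul, DrinfeldTate.KmodA.smul_invClass_self, map_zero]
  refine ⟨D.limit, hexpl, D.continuous_limit, ?_, D.limit_bijective _hv, D.limit_flip_bijective _hv,
    fun a m hm ha => ⟨DrinfeldTate.bijOn_torsionLimit φ.Points hm ha,
      DrinfeldTate.bijOn_torsionLimit φ.AdjPoints hm ha, DrinfeldTate.bijOn_dualLimit Fq hm ha, ?_⟩,
    DrinfeldTate.FqDual.nonempty_continuousLinearEquiv⟩
  · intro σ α β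
    refine DFunLike.ext _ _ fun b => ?_
    obtain ⟨a, ha, hab⟩ := DrinfeldTate.CompatiblePairing.exists_ne_zero_smul_eq_zero b
    rw [D.limit_apply_eq_pair _ _ ha hab, D.limit_apply_eq_pair _ _ ha hab,
      DrinfeldTate.HomKmodA.group_smul_apply, DrinfeldTate.HomKmodA.group_smul_apply]
    refine φ.compatiblePairing_galois σ ?_ ?_
    · rw [← map_smul, hab, map_zero]
    · rw [← map_smul, DrinfeldTate.KmodA.smul_invClass_self, map_zero]
  · intro α β n c
    have han : a ^ n ≠ 0 := pow_ne_zero n (DrinfeldTate.ne_zero_of_span_singleton_eq_pow ha)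
    rw [← map_smul]
    refine hexpl α β (c • DrinfeldTate.invClass K v (a ^ n)) (a ^ n) han ?_
    rw [smul_comm, DrinfeldTate.KmodA.smul_invClass_self, smul_zero]
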